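/- Bimodal formulas are built from propositional variables $x\,\mathrm{bin}(i)$ ($i\in\mathbb N$, $\mathrm{bin}(i)$ the binary representation of $i$) by $\neg\psi$, $(\psi_1\wedge\psi_2)$, $K\psi$ and $\Box\psi$; they are strings over the alphabet $\Sigma=\{(,),\neg,\Box,K,\wedge,x,0,1\}$. The formula $\psi_1\to\psi_2$ abbreviates $\neg(\psi_1\wedge\neg\psi_2)$, and $\mathrm{sf}(\varphi)$ is the set of subformulas of $\varphi$. In a Kripke model $M=(W,\stackrel{\Diamond}{\to},\stackrel{L}{\to},\sigma)$ the operator $\Box$ is interpreted by $\stackrel{\Diamond}{\to}$ and $K$ by $\stackrel{L}{\to}$. Let $X\in\{\mathrm{K4},\mathrm{S4}\}$; a $\mathrm{K4}$-frame is a set with a transitive relation, an $\mathrm{S4}$-frame a set with a reflexive and transitive relation. An $X\times\mathrm{S5}$-product model is a model on $U\times V$, where $(U,R)$ is an $X$-frame and $S$ is an equivalence relation on $V$, with $(u,v)\stackrel{\Diamond}{\to}(u',v')$ iff $uRu'$ and $v=v'$, and $(u,v)\stackrel{L}{\to}(u',v')$ iff $u=u'$ and $vSv'$. An $X\times\mathrm{S5}$-commutator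 model is a model in which $(W,\stackrel{\Diamond}{\to})$ is an $X$-frame, $\stackrel{L}{\to}$ is an equivalence relation, $p\stackrel{\Diamond}{\to}q\stackrel{L}{\to}r$ implies $p\stackrel{L}{\to}s\stackrel{\Diamond}{\to}r$ for some $s$, and $p\stackrel{L}{\to}q\stackrel{\Diamond}{\to}r$ implies $p\stackrel{\Diamond}{\to}s\stackrel{L}{\to}r$ for some $s$. A formula is $X\times\mathrm{S5}$-satisfiable if it holds at some point of some $X\times\mathrm{S5}$-product model; the theorem is asserted both for this notion and for the one with commutator models instead of product models. Put $$\widehat T(\varphi):=\varphi\wedge\bigwedge_{\Box\psi\in\mathrm{sf}(\varphi)}K\bigl((\Box\psi\to\psi)\wedge\Box(\Box\psi\to\psi)\bigr)$$ (bracketed to the left; $\widehat T(\varphi)=\varphi$ if no $\Box$ occurs in $\varphi$). **Theorem.** (1) The satisfiability problem of $\mathrm{S4}\times\mathrm{S5}$ is reducible in logarithmic space to that of $\mathrm{K4}\times\mathrm{S5}$: there is a function $f:\Sigma^*\to\Sigma^*$, computable by a deterministic Turing machine (with read-only input tape, write-only output tape and finitely many work tapes) that on every input of length $n$ halts and visits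 $O(\log n)$ cells of its work tapes, such that for all $w\in\Sigma^*$: $w$ is an $\mathrm{S4}\times\mathrm{S5}$-satisfiable formula if and only if $f(w)$ is a $\mathrm{K4}\times\mathrm{S5}$-satisfiable formula. Moreover $f(\varphi)=\widehat T(\varphi)$ for every formula $\varphi$, the conjuncts of $\widehat T(\varphi)$ being listed once for each occurrence of $\Box$ in $\varphi$, from left to right. (2) For every formula $\varphi$, whatever the order (and repetitions) in which the conjuncts of $\widehat T(\varphi)$ are listed: $\varphi$ is $\mathrm{S4}\times\mathrm{S5}$-satisfiable if and only if $\widehat T(\varphi)$ is $\mathrm{K4}\times\mathrm{S5}$-satisfiable. (3) If $M'=(W',\stackrel{\Diamond'}{\to},\stackrel{L'}{\to},\sigma')$ is a $\mathrm{K4}\times\mathrm{S5}$-commutator model and $M',w\models\widehat T(\varphi)$ (conjuncts listed as in (2)), then $M,w\models\varphi$ for the following model $M$, which is an $\mathrm{S4}\times\mathrm{S5}$-commutator model: its set of points is $W=\{v\in W' : w\stackrel{L'}{\to}v\text{ or }w\stackrel{L'}{\to}w'\stackrel{\Diamond'}{\to}v\text{ for some }w'\}$, its relation $\stackrel{L}{\to}$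 and its valuation are the restrictions of those of $M'$ to $W$, and its relation $\stackrel{\Diamond}{\to}$ is the reflexive closure of the restriction of $\stackrel{\Diamond'}{\to}$ to $W$. -/

import Mathlib

/-! ## Bimodal formulas -/

namespace BimodalLogic

/-- The alphabet `(, ), ¬, □, K, ∧, x, 0, 1` over which bimodal formulas are written. -/
inductive Sym : Type
  | lparen | rparen | neg | box | know | conj | x | zero | one
  deriving DecidableEq

/-- Bimodal formulas; `var i` is the propositional variable `x bin(i)`. -/
inductive Formula : Type
  | var (i : ℕ)
  | neg (φ : Formula)
  | conj (φ ψ : Formula)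
  | know (φ : Formula)
  | box (φ : Formula)
  deriving DecidableEq

namespace Formula

/-- The implication `φ → ψ`, an abbreviation for `¬(φ ∧ ¬ψ)`. -/
def imp (φ ψ : Formula) : Formula := neg (conj φ (neg ψ))

/-- Binary representation, most significant bit first, without leading zeros; `bin 0 = 0`. -/
def bin (i : ℕ) : List Sym :=
  if i = 0 then [Sym.zero]
  else (Nat.bits i).reverse.map fun b => if b then Sym.one else Sym.zero

/-- The string over the alphabet `Sym` that a formula is. -/
def code : Formula → List Sym
  | var i => Sym.x :: bin i
  | neg φ => Sym.neg :: code φ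
  | conj φ ψ => Sym.lparen :: (code φ ++ Sym.conj :: (code ψ ++ [Sym.rparen]))
  | know φ => Sym.know :: code φ
  | box φ => Sym.box :: code φ

/-- The set `sf(φ)` of subformulas of `φ` (including `φ`). -/
def sf : Formula → Set Formula
  | var i => {var i}
  | neg φ => insert (neg φ) (sf φ)
  | conj φ ψ => insert (conj φ ψ) (sf φ ∪ sf ψ)
  | know φ => insert (know φ) (sf φ)
  | box φ => insert (box φ) (sf φ)

/-- The formulas `ψ` that stand behind an occurrence of `□` in `φ`, from left to right. -/
def boxArgs : Formula → List Formula
  | var _ => []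
  | neg φ => boxArgs φ
  | conj φ ψ => boxArgs φ ++ boxArgs ψ
  | know φ => boxArgs φ
  | box φ => φ :: boxArgs φ

/-- The list `l` enumerates (in any order, possibly with repetitions) the formulas `ψ` with
`□ψ ∈ sf(φ)`. -/
def Enumerates (l : List Formula) (φ : Formula) : Prop :=
  ∀ ψ, ψ ∈ l ↔ box ψ ∈ sf φ

theorem boxArgs_enumerates (φ : Formula) : Enumerates (boxArgs φ) φ := by
  intro ψ
  induction φ with
  | var i => simp [boxArgs, sf]
  | neg φ ih => simp [boxArgs, sf, ih]
  | conj φ χ ih₁ ih₂ => simp [boxArgs, sf, ih₁, ih₂]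
  | know φ ih => simp [boxArgs, sf, ih]
  | box φ ih => simp [boxArgs, sf, ih]

/-- The formula `K((□ψ → ψ) ∧ □(□ψ → ψ))`. -/
def reflAxiom (ψ : Formula) : Formula :=
  know (conj (imp (box ψ) ψ) (box (imp (box ψ) ψ)))

/-- The conjunction `φ ∧ ⋀_{ψ ∈ l} K((□ψ → ψ) ∧ □(□ψ → ψ))`, bracketed to the left
(it is `φ` itself if `l` is empty). -/
def withReflAxioms (φ : Formula) (l : List Formula) : Formula :=
  l.foldl (fun χ ψ => conj χ (reflAxiom ψ)) φ

/-- The translation `φ ↦ φ ∧ ⋀_{□ψ ∈ sf(φ)} K((□ψ → ψ) ∧ □(□ψ → ψ))`, the conjuncts being listed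
in the order in which the subformulas `□ψ` occur in `φ`. -/
def translate (φ : Formula) : Formula := withReflAxioms φ (boxArgs φ)

end Formula

/-! ## Models and satisfiability -/

/-- A bimodal Kripke model: `dia` is the relation for `□`, `el` the one for `K`. -/
structure Model (W : Type) where
  dia : W → W → Prop
  el : W → W → Prop
  val : ℕ → Set W

/-- `M, w ⊨ φ`. -/
def Model.Holds {W : Type} (M : Model W) : W → Formula → Prop
  | w, .var i => w ∈ M.val i
  | w, .neg φ => ¬ M.Holds w φ
  | w, .conj φ ψ => M.Holds w φ ∧ M.Holds w ψ
  | w, .know φ => ∀ v, M.el w v → M.Holds v φ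
  | w, .box φ => ∀ v, M.dia w v → M.Holds v φ

/-- The two unimodal logics used as the first factor. -/
inductive Logic : Type
  | K4 | S4

/-- `K4`-frames are the transitive ones, `S4`-frames the reflexive and transitive ones. -/
def Logic.IsFrame {W : Type} : Logic → (W → W → Prop) → Prop
  | .K4, R => ∀ u v w, R u v → R v w → R u w
  | .S4, R => (∀ w, R w w) ∧ ∀ u v w, R u v → R v w → R u w

/-- `M` is an `X × S5`-commutator model. -/
structure Model.IsCommutator {W : Type} (X : Logic) (M : Model W) : Prop where
  frame : X.IsFrame M.dia
  equiv : Equivalence M.el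
  left_comm : ∀ p q r, M.dia p q → M.el q r → ∃ s, M.el p s ∧ M.dia s r
  right_comm : ∀ p q r, M.el p q → M.dia q r → ∃ s, M.dia p s ∧ M.el s r

/-- The model on the product of the frames `(U, R)` and `(V, S)` with valuation `σ`. -/
def productModel {U V : Type} (R : U → U → Prop) (S : V → V → Prop) (σ : ℕ → Set (U × V)) :
    Model (U × V) where
  dia p q := R p.1 q.1 ∧ p.2 = q.2
  el p q := p.1 = q.1 ∧ S p.2 q.2
  val := σ

/-- `φ` is `X × S5`-satisfiable: it holds at a point of an `X × S5`-product model. -/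
def ProductSat (X : Logic) (φ : Formula) : Prop :=
  ∃ (U V : Type) (R : U → U → Prop) (S : V → V → Prop) (σ : ℕ → Set (U × V)),
    X.IsFrame R ∧ Equivalence S ∧ ∃ p, (productModel R S σ).Holds p φ

/-- `φ` holds at a point of an `X × S5`-commutator model. -/
def CommutatorSat (X : Logic) (φ : Formula) : Prop :=
  ∃ (W : Type) (M : Model W), M.IsCommutator X ∧ ∃ w, M.Holds w φ

/-- The points that are reachable from `w`. -/
def Model.reachable {W : Type} (M : Model W) (w : W) : Set W :=
  {v | M.el w v ∨ ∃ u, M.el w u ∧ M.dia u v}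

/-- The submodel on the points reachable from `w`, with the reflexive closure of the relation
`dia`. -/
def Model.reflReach {W : Type} (M : Model W) (w : W) : Model (M.reachable w) where
  dia u v := M.dia u v ∨ u = v
  el u v := M.el u v
  val i := {v | (v : W) ∈ M.val i}

/-- The language of all strings that are formulas with the property `P`. -/
def formulaLanguage (P : Formula → Prop) : Language Sym :=
  {w | ∃ φ : Formula, φ.code = w ∧ P φ}

end BimodalLogic

/-! ## Logarithmic space -/

namespace LogSpace

/-- What the input head sees: a letter of the input or one of the two end markers. -/
inductive InCell (A : Type) : Type
  | leftEnd
  | letter (a : A)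
  | rightEnd

/-- The three moves of a head. -/
inductive Move : Type
  | left | stay | right

/-- A deterministic Turing machine with a two-way read-only input tape, `k` work tapes and a
one-way write-only output tape. In one step it changes its state, moves its input head, rewrites
the scanned cell of each work tape and moves the head there, and writes at most one letter on the
output tape. It halts where `δ` is `none`. -/
structure Machine (A B : Type) where
  k : ℕ
  Q : Type
  finiteQ : Finite Q
  Γ : Type
  finiteΓ : Finite Γ
  blank : Γ
  start : Q
  δ : Q → InCell A → (Fin k → Γ) → Option (Q × Move × (Fin k → Γ × Move) × Option B)

/-- Configurations. The input head stands on a cell `0, …, n + 1`, where `n` is the length of the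
input; the cells of a work tape are numbered by `ℕ`. -/
structure Cfg {A B : Type} (M : Machine A B) where
  state : M.Q
  inPos : ℕ
  tape : Fin M.k → ℕ → M.Γ
  pos : Fin M.k → ℕ
  out : List B

/-- The content of cell `i` of the input tape: the input `w` is in the cells `1, …, |w|`. -/
def inCell {A : Type} (w : List A) : ℕ → InCell A
  | 0 => .leftEnd
  | i + 1 => match w[i]? with
    | some a => .letter a
    | none => .rightEnd

/-- Moving a head on a tape whose leftmost cell is `0`. -/
def Move.apply : Move → ℕ → ℕ
  | .left, i => i - 1
  | .stay, i => i
  | .right, i => i + 1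

/-- One step on input `w`; `none` if the machine has halted. The input head never leaves the cells
`0, …, |w| + 1`. -/
def Machine.step {A B : Type} (M : Machine A B) (w : List A) (c : Cfg M) : Option (Cfg M) :=
  (M.δ c.state (inCell w c.inPos) fun i => c.tape i (c.pos i)).map fun r =>
    { state := r.1
      inPos := min (r.2.1.apply c.inPos) (w.length + 1)
      tape := fun i => Function.update (c.tape i) (c.pos i) (r.2.2.1 i).1
      pos := fun i => (r.2.2.1 i).2.apply (c.pos i)
      out := c.out ++ r.2.2.2.toList }

/-- The initial configuration. -/
def Machine.init {A B : Type} (M : Machine A B) : Cfg M where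
  state := M.start
  inPos := 0
  tape := fun _ _ => M.blank
  pos := fun _ => 0
  out := []

/-- The configuration `c` occurs in the computation of `M` on input `w`. -/
def Machine.Reaches {A B : Type} (M : Machine A B) (w : List A) (c : Cfg M) : Prop :=
  Relation.ReflTransGen (fun c₁ c₂ => M.step w c₁ = some c₂) M.init c

/-- On input `w` the machine halts, with `v` on its output tape. -/
def Machine.Outputs {A B : Type} (M : Machine A B) (w : List A) (v : List B) : Prop :=
  ∃ c, M.Reaches w c ∧ M.step w c = none ∧ c.out = v

/-- On input `w` the machine visits only the first `s` cells of each work tape. -/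
def Machine.UsesSpace {A B : Type} (M : Machine A B) (w : List A) (s : ℕ) : Prop :=
  ∀ c, M.Reaches w c → ∀ i, c.pos i < s

/-- `f` is computable in logarithmic space: some deterministic Turing machine computes `f` and
visits `O(log n)` cells of its work tapes on inputs of length `n`. -/
def Computable {A B : Type} (f : List A → List B) : Prop :=
  ∃ (M : Machine A B) (C : ℕ), ∀ w : List A,
    M.Outputs w (f w) ∧ M.UsesSpace w (C * (Nat.log 2 w.length + 1))

/-- `f` is a logspace reduction of the language `L` to the language `L'`. -/
def IsReduction {A B : Type} (f : List A → List B) (L : Language A) (L' : Language B) : Prop :=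
  Computable f ∧ ∀ w, w ∈ L ↔ f w ∈ L'

end LogSpace

open BimodalLogic

namespace BimodalLogic

/-! ## Reflexive closures of transitive models -/

/-! The added conjuncts say that `□ψ → ψ` holds, for every `□ψ ∈ sf(φ)`, at all points reachable by
an `el`-step, possibly followed by a `dia`-step. By commutation and transitivity this set is closed
under both relations. Making `dia` reflexive there changes no truth value of a subformula of `φ`: a
new loop at `p` only demands `ψ` where `□ψ` already holds (`Model.holds_iff_of_reflClosure`). In a
product the reachable points form a rectangle, so the result is again a product. Conversely,
reflexive models satisfy all added conjuncts.

On strings, the translation writes one `(` per `□`, then the input, then a block for each `□`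
containing four copies of the formula behind it. The end of that formula is found by a scanner that
only counts open parentheses (`scan_code`). The scanner is no parser and accepts some strings that
are not formulas. This does no harm: if the output is a formula, then behind the initial parentheses
it has a formula `ψ` as a prefix, and the scanner, which cuts off both `ψ` and the input there,
shows that they agree. A string rejected by the scanner gets a final `¬`, with which no formula ends
(`exists_code_of_translateString`).

For logarithmic space the function is programmed on a machine with two counters bounded by the input
length: the parenthesis depth, and the distance to walk back after a copy.
`CounterMachine.computable` simulates such machines once and for all, keeping each counter in binary
on a work tape. -/

theorem Formula.self_mem_sf (φ : Formula) : φ ∈ φ.sf := by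
  cases φ <;> simp [Formula.sf]

theorem Model.holds_withReflAxioms {W : Type} (M : Model W) (w : W) (φ : Formula)
    (l : List Formula) :
    M.Holds w (φ.withReflAxioms l) ↔ M.Holds w φ ∧ ∀ ψ ∈ l, M.Holds w ψ.reflAxiom := by
  induction l generalizing φ with
  | nil => simp [Formula.withReflAxioms]
  | cons ψ l ih =>
    have := ih (φ.conj ψ.reflAxiom)
    simp only [Formula.withReflAxioms, List.foldl_cons] at this ⊢
    rw [this]
    simp [Model.Holds, and_assoc]

theorem Model.holds_imp {W : Type} (M : Model W) (w : W) (φ ψ : Formula) :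
    M.Holds w (φ.imp ψ) ↔ (M.Holds w φ → M.Holds w ψ) := by
  simp [Formula.imp, Model.Holds]

/-- A reflexivity axiom says that `□ψ → ψ` holds at all reachable points. -/
theorem Model.holds_reflAxiom {W : Type} (M : Model W) (w : W) (ψ : Formula) :
    M.Holds w ψ.reflAxiom ↔
      ∀ v ∈ M.reachable w, M.Holds v ψ.box → M.Holds v ψ := by
  have h : M.Holds w ψ.reflAxiom ↔ ∀ u, M.el w u → (M.Holds u (ψ.box.imp ψ) ∧
    ∀ v, M.dia u v → M.Holds v (ψ.box.imp ψ)) := Iff.rfl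
  rw [h]
  simp only [Model.holds_imp]
  constructor
  · rintro h v (hv | ⟨u, hu, hv⟩)
    · exact (h v hv).1
    · exact (h u hu).2 v hv
  · exact fun h u hu => ⟨h u (Or.inl hu), fun v hv => h v (Or.inr ⟨u, hu, hv⟩)⟩

/-- Passing to the reflexive closure of the relation for `□` on a generated submodel preserves the
truth of `φ` if `□ψ → ψ` holds throughout the submodel for all subformulas `□ψ` of `φ`. -/
theorem Model.holds_iff_of_reflClosure {W W' : Type} (M : Model W) (N : Model W') (g : W' → W)
    (hval : ∀ i p, p ∈ N.val i ↔ g p ∈ M.val i)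
    (hel : ∀ p q, N.el p q ↔ M.el (g p) (g q))
    (hdia : ∀ p q, N.dia p q ↔ M.dia (g p) (g q) ∨ p = q)
    (hgel : ∀ p v, M.el (g p) v → v ∈ Set.range g)
    (hgdia : ∀ p v, M.dia (g p) v → v ∈ Set.range g) (φ : Formula)
    (hφ : ∀ ψ, ψ.box ∈ φ.sf → ∀ p, M.Holds (g p) ψ.box → M.Holds (g p) ψ) (p : W') :
    N.Holds p φ ↔ M.Holds (g p) φ := by
  induction φ generalizing p with
  | var i => exact hval i p
  | neg φ ih =>
    exact not_congr (ih (fun ψ h => hφ ψ (Or.inr h)) p)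
  | conj φ χ ih₁ ih₂ =>
    exact and_congr (ih₁ (fun ψ h => hφ ψ (Or.inr (Or.inl h))) p)
      (ih₂ (fun ψ h => hφ ψ (Or.inr (Or.inr h))) p)
  | know φ ih =>
    have ih := ih (fun ψ h => hφ ψ (Or.inr h))
    constructor
    · intro h v hv
      obtain ⟨q, rfl⟩ := hgel p v hv
      exact (ih q).1 (h q ((hel p q).2 hv))
    · exact fun h q hq => (ih q).2 (h _ ((hel p q).1 hq))
  | box φ ih =>
    have ih := ih (fun ψ h => hφ ψ (Or.inr h))
    constructor
    · intro h v hv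
      obtain ⟨q, rfl⟩ := hgdia p v hv
      exact (ih q).1 (h q ((hdia p q).2 (Or.inl hv)))
    · intro h q hq
      rcases (hdia p q).1 hq with hq | rfl
      · exact (ih q).2 (h _ hq)
      -- The new loop at `p`: the only place where the reflexivity axioms are needed.
      · exact (ih p).2 (hφ φ (Formula.self_mem_sf _) p h)

theorem Logic.IsFrame.trans {W : Type} {X : Logic} {R : W → W → Prop} (h : X.IsFrame R) :
    Logic.K4.IsFrame R := by
  cases X
  · exact h
  · exact h.2

theorem Logic.isFrame_reflClosure {W W' : Type} {R : W → W → Prop} (h : Logic.K4.IsFrame R)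
    (g : W' → W) : Logic.S4.IsFrame fun p q => R (g p) (g q) ∨ p = q := by
  refine ⟨fun w => Or.inr rfl, ?_⟩
  rintro u v w (h₁ | rfl) (h₂ | rfl)
  · exact Or.inl (h _ _ _ h₁ h₂)
  · exact Or.inl h₁
  · exact Or.inl h₂
  · exact Or.inr rfl

theorem Model.holds_withReflAxioms_of_refl {W : Type} (M : Model W) (hM : ∀ w, M.dia w w) (w : W)
    (φ : Formula) (l : List Formula) (h : M.Holds w φ) : M.Holds w (φ.withReflAxioms l) :=
  (M.holds_withReflAxioms w φ l).2 ⟨h, fun ψ _ =>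
    (M.holds_reflAxiom w ψ).2 fun v _ hv => hv v (hM v)⟩

/-! ### Reachable points in commutator models -/

theorem Model.mem_reachable_self {W : Type} {M : Model W} (hM : M.IsCommutator .K4) (w : W) :
    w ∈ M.reachable w := Or.inl (hM.equiv.refl w)

/-- Left commutation moves the new `el`-step in front of the `dia`-step, where it merges with the
first `el`-step. -/
theorem Model.mem_reachable_of_el {W : Type} {M : Model W} (hM : M.IsCommutator .K4) (w : W)
    {u v : W} (hu : u ∈ M.reachable w) (h : M.el u v) :
    v ∈ M.reachable w := by
  rcases hu with hu | ⟨t, ht, hu⟩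
  · exact Or.inl (hM.equiv.trans hu h)
  · obtain ⟨s, hs, hv⟩ := hM.left_comm _ _ _ hu h
    exact Or.inr ⟨s, hM.equiv.trans ht hs, hv⟩

theorem Model.mem_reachable_of_dia {W : Type} {M : Model W} (hM : M.IsCommutator .K4) (w : W)
    {u v : W} (hu : u ∈ M.reachable w) (h : M.dia u v) :
    v ∈ M.reachable w := by
  rcases hu with hu | ⟨t, ht, hu⟩
  · exact Or.inr ⟨u, hu, h⟩
  · exact Or.inr ⟨t, ht, hM.frame _ _ _ hu h⟩

/-- The points completing the commutation squares stay in the submodel, which is closed under both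
relations; squares on a new loop are completed trivially. -/
theorem Model.isCommutator_reflReach {W : Type} {M : Model W} (hM : M.IsCommutator .K4) (w : W) :
    (M.reflReach w).IsCommutator .S4 where
  frame := Logic.isFrame_reflClosure hM.frame (Subtype.val : M.reachable w → W)
  equiv := ⟨fun p => hM.equiv.refl _, fun h => hM.equiv.symm h, fun h h' => hM.equiv.trans h h'⟩
  left_comm := by
    rintro p q r (h | h) hr
    · obtain ⟨s, hs, h'⟩ := hM.left_comm _ _ _ h hr
      exact ⟨⟨s, Model.mem_reachable_of_el hM w p.2 hs⟩, hs, Or.inl h'⟩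
    · cases h
      exact ⟨r, hr, Or.inr rfl⟩
  right_comm := by
    rintro p q r h (hr | hr)
    · obtain ⟨s, hs, h'⟩ := hM.right_comm _ _ _ h hr
      exact ⟨⟨s, Model.mem_reachable_of_dia hM w p.2 hs⟩, Or.inl hs, h'⟩
    · cases hr
      exact ⟨p, Or.inr rfl, h⟩

theorem Model.reflReach_holds {W : Type} {M : Model W} (hM : M.IsCommutator .K4) (w : W)
    {φ : Formula} {l : List Formula} (hl : Formula.Enumerates l φ)
    (h : M.Holds w (φ.withReflAxioms l)) :
    (M.reflReach w).Holds ⟨w, Model.mem_reachable_self hM w⟩ φ := by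
  obtain ⟨h₁, h₂⟩ := (M.holds_withReflAxioms w φ l).1 h
  refine (M.holds_iff_of_reflClosure (M.reflReach w) Subtype.val (fun _ _ => Iff.rfl)
    (fun _ _ => Iff.rfl) (fun _ _ => Iff.rfl) (fun p v hv => ?_) (fun p v hv => ?_) φ
    (fun ψ hψ p => ?_) _).2 h₁
  · exact ⟨⟨v, Model.mem_reachable_of_el hM w p.2 hv⟩, rfl⟩
  · exact ⟨⟨v, Model.mem_reachable_of_dia hM w p.2 hv⟩, rfl⟩
  · exact (M.holds_reflAxiom w ψ).1 (h₂ ψ ((hl ψ).2 hψ)) p p.2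

/-! ### Transfer of satisfiability -/

theorem commutatorSat_iff {φ : Formula} {l : List Formula} (hl : Formula.Enumerates l φ) :
    CommutatorSat .S4 φ ↔ CommutatorSat .K4 (φ.withReflAxioms l) := by
  constructor
  · rintro ⟨W, M, hM, w, h⟩
    exact ⟨W, M, ⟨hM.frame.trans, hM.equiv, hM.left_comm, hM.right_comm⟩, w,
      M.holds_withReflAxioms_of_refl hM.frame.1 w φ l h⟩
  · rintro ⟨W, M, hM, w, h⟩
    exact ⟨_, _, Model.isCommutator_reflReach hM w, _, Model.reflReach_holds hM w hl h⟩

theorem productSat_iff {φ : Formula} {l : List Formula} (hl : Formula.Enumerates l φ) :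
    ProductSat .S4 φ ↔ ProductSat .K4 (φ.withReflAxioms l) := by
  constructor
  · rintro ⟨U, V, R, S, σ, hR, hS, p, h⟩
    exact ⟨U, V, R, S, σ, hR.trans, hS, p,
      (productModel R S σ).holds_withReflAxioms_of_refl (fun w => ⟨hR.1 _, rfl⟩) p φ l h⟩
  · rintro ⟨U, V, R, S, σ, hR, hS, ⟨u, v⟩, h⟩
    obtain ⟨h₁, h₂⟩ := (Model.holds_withReflAxioms _ _ φ l).1 h
    -- The points reachable from `(u, v)` are exactly the rectangle `U' × V'`. Since `dia` fixes the
    -- second coordinate, its reflexive closure on the product comes from the reflexive closure of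
    -- `R` on `U'`.
    let U' := {a // a = u ∨ R u a}
    let V' := {b // S v b}
    let g : U' × V' → U × V := fun p => (p.1, p.2)
    refine ⟨U', V', fun a b => R a b ∨ a = b, fun a b => S a b, fun i => g ⁻¹' σ i,
      Logic.isFrame_reflClosure hR Subtype.val, hS.comap Subtype.val,
      (⟨u, Or.inl rfl⟩, ⟨v, hS.refl v⟩), ?_⟩
    refine (Model.holds_iff_of_reflClosure (productModel R S σ) _ g (fun _ _ => Iff.rfl)
      ?_ ?_ ?_ ?_ φ (fun ψ hψ p => ?_) _).2 h₁
    · intro p q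
      exact and_congr_left' Subtype.ext_iff
    · rintro ⟨a, b⟩ ⟨a', b'⟩
      have h : (b : V) = b' ↔ b = b' := Subtype.ext_iff.symm
      simp only [productModel, g, Prod.mk.injEq, h]
      tauto
    · rintro ⟨a, b⟩ ⟨a', b'⟩ ⟨h, h'⟩
      exact ⟨(a, ⟨b', hS.trans b.2 h'⟩), Prod.ext h rfl⟩
    · rintro ⟨a, b⟩ ⟨a', b'⟩ ⟨h, h'⟩
      refine ⟨(⟨a', Or.inr ?_⟩, b), Prod.ext rfl h'⟩
      rcases a.2 with ha | ha
      · exact ha ▸ h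
      · exact hR _ _ _ ha h
    · refine (Model.holds_reflAxiom _ _ ψ).1 (h₂ ψ ((hl ψ).2 hψ)) (g p) ?_
      obtain ⟨⟨a, rfl | ha⟩, b⟩ := p
      · exact Or.inl ⟨rfl, b.2⟩
      · exact Or.inr ⟨(u, b), ⟨rfl, b.2⟩, ha, rfl⟩

end BimodalLogic

namespace BimodalLogic

/-! ## Scanning formulas with one counter -/

def Sym.IsDigit (c : Sym) : Prop := c = .zero ∨ c = .one

instance : DecidablePred Sym.IsDigit := fun c => by unfold Sym.IsDigit; infer_instance

/-- The effect of a letter on the number of open parentheses. -/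
inductive DepthOp : Type
  | inc | dec | nop

def DepthOp.apply : DepthOp → ℕ → ℕ
  | inc, d => d + 1
  | dec, d => d - 1
  | nop, d => d

/-- The transition of the scanner. The first argument tells whether a term has just been completed
(up to digits), the second one whether no parenthesis is open. The scanner stops in front of `c`
if the value is `none`. -/
def scanStep : Bool → Bool → Sym → Option (Bool × DepthOp)
  | false, _, .x => some (true, .nop)
  | false, _, .lparen => some (false, .inc)
  | false, _, _ => some (false, .nop)
  | true, z, c =>
    if c.IsDigit then some (true, .nop)
    else if z then none
    else if c = .rparen then some (true, .dec)
    else some (false, .nop)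

/-- The prefix of a string that the scanner reads, starting with `d` open parentheses. -/
def scan : Bool → ℕ → List Sym → List Sym
  | _, _, [] => []
  | m, d, c :: s =>
    match scanStep m (d = 0) c with
    | none => []
    | some (m', o) => c :: scan m' (o.apply d) s

/-- The mode and the number of open parentheses when the scanner stops. -/
def scanEnd : Bool → ℕ → List Sym → Bool × ℕ
  | m, d, [] => (m, d)
  | m, d, c :: s =>
    match scanStep m (d = 0) c with
    | none => (m, d)
    | some (m', o) => scanEnd m' (o.apply d) s

/-- The scanner reads `w` completely and then sees a complete term. -/
def ScanOk (w : List Sym) : Prop := scan false 0 w = w ∧ scanEnd false 0 w = (true, 0)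

/-- A digit directly behind a formula would be read as part of the index of its last variable. -/
def NoDigitHead (s : List Sym) : Prop := ∀ c ∈ s.head?, ¬ c.IsDigit

theorem isDigit_of_mem_bin {i : ℕ} {c : Sym} (hc : c ∈ Formula.bin i) : c.IsDigit := by
  unfold Formula.bin at hc
  split_ifs at hc
  · simp at hc; exact Or.inl hc
  · simp only [List.mem_map] at hc
    obtain ⟨b, -, rfl⟩ := hc
    cases b
    · exact Or.inl rfl
    · exact Or.inr rfl

theorem scan_digits {l : List Sym} (hl : ∀ c ∈ l, c.IsDigit) (d : ℕ) (t : List Sym) :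
    scan true d (l ++ t) = l ++ scan true d t ∧ scanEnd true d (l ++ t) = scanEnd true d t := by
  induction l with
  | nil => exact ⟨rfl, rfl⟩
  | cons c l ih =>
    have hc := hl c (by simp)
    have := ih fun c hc => hl c (by simp [hc])
    simp [scan, scanEnd, scanStep, hc, this, DepthOp.apply]

/-- Inside a conjunction the depth is positive, so the scanner passes the inner `∧` and the closing
parenthesis, which restores the depth `d`. -/
theorem scan_code (φ : Formula) (d : ℕ) (t : List Sym) :
    scan false d (φ.code ++ t) = φ.code ++ scan true d t ∧
      scanEnd false d (φ.code ++ t) = scanEnd true d t := by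
  induction φ generalizing d t with
  | var i =>
    have := scan_digits (fun c => isDigit_of_mem_bin (i := i)) d t
    simp [Formula.code, scan, scanEnd, scanStep, this, DepthOp.apply]
  | conj φ ψ ih₁ ih₂ =>
    simp [Formula.code, scan, scanEnd, scanStep, ih₁, ih₂, DepthOp.apply, Sym.IsDigit]
  | _ φ ih => simp [Formula.code, scan, scanEnd, scanStep, ih, DepthOp.apply]

theorem scan_true_zero {t : List Sym} (ht : NoDigitHead t) :
    scan true 0 t = [] ∧ scanEnd true 0 t = (true, 0) := by
  cases t with
  | nil => simp [scan, scanEnd]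
  | cons c t =>
    have : ¬ c.IsDigit := ht c (by simp)
    simp [scan, scanEnd, scanStep, this]

theorem scan_code_append (φ : Formula) {t : List Sym} (ht : NoDigitHead t) :
    scan false 0 (φ.code ++ t) = φ.code := by
  simp [scan_code, scan_true_zero ht]

theorem scanOk_code (φ : Formula) : ScanOk φ.code := by
  have h := scan_code φ 0 []
  rw [List.append_nil] at h
  refine ⟨by simp [h, scan], by simp [h, scanEnd]⟩

theorem scan_append {m : Bool} {d : ℕ} {w : List Sym} (h : scan m d w = w) (t : List Sym) :
    scan m d (w ++ t) = w ++ scan (scanEnd m d w).1 (scanEnd m d w).2 t := by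
  induction w generalizing m d with
  | nil => rfl
  | cons c w ih =>
    simp only [scan, scanEnd, List.cons_append] at h ⊢
    split at h
    · simp at h
    · rename_i m' o heq
      simp only [List.cons.injEq, true_and] at h
      simp [ih h]

/-! ## Unique readability -/

theorem noDigitHead_nil : NoDigitHead [] := by simp [NoDigitHead]

theorem noDigitHead_cons {c : Sym} {s : List Sym} (h : ¬ c.IsDigit) : NoDigitHead (c :: s) := by
  simpa [NoDigitHead] using h

theorem Formula.bin_injective : Function.Injective Formula.bin := by
  refine Function.LeftInverse.injective
    (g := fun s => Nat.ofDigits 2 (s.reverse.map fun c => if c = Sym.one then 1 else 0)) fun i => ?_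
  unfold Formula.bin
  split_ifs with hi
  · simp [hi]
  · conv_rhs => rw [← Nat.ofDigits_digits 2 i, Nat.digits_two_eq_bits]
    simp only [List.map_reverse, List.reverse_reverse, List.map_map]
    congr 1
    refine List.map_congr_left fun b _ => ?_
    cases b <;> simp

theorem Formula.code_injective : Function.Injective Formula.code := by
  intro φ
  induction φ with
  | var i => intro ψ h; cases ψ <;> simp [code] at h; rw [bin_injective h]
  | neg φ ih => intro ψ h; cases ψ <;> simp [code] at h; rw [ih h]
  | know φ ih => intro ψ h; cases ψ <;> simp [code] at h; rw [ih h]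
  | box φ ih => intro ψ h; cases ψ <;> simp [code] at h; rw [ih h]
  | conj φ χ ih₁ ih₂ =>
    intro ψ h
    cases ψ <;> simp only [code, List.cons.injEq, reduceCtorEq, false_and, true_and] at h
    rename_i φ' χ'
    have hd : ∀ s, NoDigitHead (Sym.conj :: s) := fun s =>
      noDigitHead_cons (by simp [Sym.IsDigit])
    -- Both are what the scanner cuts off from the same string, as `∧` follows either of them.
    have h₁ : φ.code = φ'.code := by
      rw [← scan_code_append φ (hd _), h, scan_code_append φ' (hd _)]
    rw [h₁] at h
    rw [ih₁ h₁, ih₂ (by simpa using h)]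

/-- A code ends with a digit or a closing parenthesis, so a final `¬` can mark rejected inputs. -/
theorem Formula.getLast_code_ne (φ : Formula) : φ.code.getLast? ≠ some Sym.neg := by
  have key : ∀ (c : Sym) (s : List Sym), s ≠ [] → (c :: s).getLast? = s.getLast? :=
    fun c s hs => by simp [List.getLast?_cons, List.getLast?_eq_some_getLast hs]
  have hne : ∀ ψ : Formula, ψ.code ≠ [] := fun ψ => by cases ψ <;> simp [code]
  induction φ with
  | var i =>
    intro h
    have := List.mem_of_getLast? h
    simp only [code, List.mem_cons, reduceCtorEq, false_or] at this
    simpa [Sym.IsDigit] using isDigit_of_mem_bin this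
  | conj φ ψ => simp [code, List.getLast?_cons]
  | neg φ ih => rw [code, key _ _ (hne φ)]; exact ih
  | know φ ih => rw [code, key _ _ (hne φ)]; exact ih
  | box φ ih => rw [code, key _ _ (hne φ)]; exact ih

/-! ## The translation as a function on strings -/

/-- The string that is appended for a subformula `□ψ`, where `s` is the code of `ψ`. -/
def reflBlock (s : List Sym) : List Sym :=
  [.conj, .know, .lparen, .neg, .lparen, .box] ++ s ++ [.conj, .neg] ++ s ++
    [.rparen, .conj, .box, .neg, .lparen, .box] ++ s ++ [.conj, .neg] ++ s ++
    [.rparen, .rparen, .rparen]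

/-- The strings appended for all occurrences of `□`. -/
def reflBlocks : List Sym → List Sym
  | [] => []
  | c :: s => (if c = .box then reflBlock (scan false 0 s) else []) ++ reflBlocks s

open Classical in
/-- The translation as a function on strings. -/
noncomputable def translateString (w : List Sym) : List Sym :=
  List.replicate (w.count Sym.box) Sym.lparen ++
    (scan false 0 w ++ if ScanOk w then reflBlocks w else [Sym.neg])

theorem reflBlocks_append {l : List Sym} (hl : Sym.box ∉ l) (t : List Sym) :
    reflBlocks (l ++ t) = reflBlocks t := by
  induction l with
  | nil => rfl
  | cons c l ih =>
    simp only [List.mem_cons, not_or] at hl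
    simp [reflBlocks, Ne.symm hl.1, ih hl.2]

theorem box_notMem_bin (i : ℕ) : Sym.box ∉ Formula.bin i := fun h => by
  simpa [Sym.IsDigit] using isDigit_of_mem_bin h

theorem reflBlocks_code (φ : Formula) {t : List Sym} (ht : NoDigitHead t) :
    reflBlocks (φ.code ++ t) =
      (φ.boxArgs.flatMap fun ψ => reflBlock ψ.code) ++ reflBlocks t := by
  induction φ generalizing t with
  | var i =>
    simp [Formula.code, Formula.boxArgs, reflBlocks, reflBlocks_append (box_notMem_bin i)]
  | conj φ ψ ih₁ ih₂ =>
    have h₁ := ih₁ (t := Sym.conj :: (ψ.code ++ ([Sym.rparen] ++ t)))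
      (noDigitHead_cons (by simp [Sym.IsDigit]))
    have h₂ := ih₂ (t := [Sym.rparen] ++ t) (noDigitHead_cons (by simp [Sym.IsDigit]))
    simp [Formula.code, Formula.boxArgs, reflBlocks] at h₁ h₂ ⊢
    simp [h₁, h₂]
  | box φ ih =>
    simp [Formula.code, Formula.boxArgs, reflBlocks, ih ht, scan_code_append φ ht]
  | _ φ ih => simp [Formula.code, Formula.boxArgs, reflBlocks, ih ht]

theorem count_box_code (φ : Formula) : φ.code.count Sym.box = φ.boxArgs.length := by
  induction φ with
  | var i => simp [Formula.code, Formula.boxArgs, List.count_eq_zero.2 (box_notMem_bin i)]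
  | conj φ ψ ih₁ ih₂ => simp [Formula.code, Formula.boxArgs, ih₁, ih₂]
  | _ φ ih => simp [Formula.code, Formula.boxArgs, ih]

/-- Bracketing to the left collects the opening parentheses of the new conjunctions at the front;
the closing ones are the last letters of the blocks. -/
theorem code_withReflAxioms (φ : Formula) (l : List Formula) :
    (φ.withReflAxioms l).code = List.replicate l.length Sym.lparen ++
      (φ.code ++ l.flatMap fun ψ => reflBlock ψ.code) := by
  induction l generalizing φ with
  | nil => simp [Formula.withReflAxioms]
  | cons ψ l ih =>
    have h := ih (φ.conj ψ.reflAxiom)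
    rw [Formula.withReflAxioms] at h ⊢
    rw [List.foldl_cons, h, List.length_cons, List.replicate_succ']
    simp [Formula.code, Formula.reflAxiom, Formula.imp, reflBlock]

theorem translateString_code (φ : Formula) : translateString φ.code = φ.translate.code := by
  have h := reflBlocks_code φ noDigitHead_nil
  rw [List.append_nil] at h
  rw [Formula.translate, code_withReflAxioms, translateString, count_box_code,
    if_pos (scanOk_code φ), (scanOk_code φ).1, h]
  simp [reflBlocks]

/-! ### Strings that are not formulas -/

theorem noDigitHead_reflBlocks (w : List Sym) : NoDigitHead (reflBlocks w) := by
  induction w with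
  | nil => exact noDigitHead_nil
  | cons c w ih =>
    rw [reflBlocks]
    split_ifs
    · exact noDigitHead_cons (by simp [Sym.IsDigit])
    · exact ih

/-- Only a conjunction begins with `(`. Stripping it leaves the left conjunct followed by `∧`, hence
again a formula in front of a non-digit. -/
theorem exists_code_of_replicate_append (m : ℕ) {s t : List Sym} {φ : Formula}
    (ht : NoDigitHead t) (h : φ.code ++ t = List.replicate m Sym.lparen ++ s) :
    ∃ (ψ : Formula) (t' : List Sym), NoDigitHead t' ∧ s = ψ.code ++ t' := by
  induction m generalizing φ t with
  | zero => exact ⟨φ, t, ht, by simpa using h.symm⟩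
  | succ m ih =>
    cases φ <;> simp only [Formula.code, List.replicate_succ, List.cons_append,
      List.cons.injEq, reduceCtorEq, false_and, true_and, List.append_assoc] at h
    exact ih (noDigitHead_cons (by simp [Sym.IsDigit])) h

/-- A string whose translation is a formula is a formula. -/
theorem exists_code_of_translateString {w : List Sym} {χ : Formula}
    (h : χ.code = translateString w) : ∃ φ : Formula, φ.code = w := by
  rw [translateString] at h
  split_ifs at h with hw
  · obtain ⟨ψ, t, ht, hs⟩ := exists_code_of_replicate_append _ noDigitHead_nil
      ((List.append_nil _).trans h)
    refine ⟨ψ, ?_⟩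
    -- From the same string the scanner cuts off `ψ.code` when it is read as `ψ.code ++ t`, and `w`
    -- when it is read as `w` followed by blocks.
    rw [← scan_code_append ψ ht, ← hs, hw.1, scan_append hw.1, hw.2,
      (scan_true_zero (noDigitHead_reflBlocks w)).1, List.append_nil]
  · exact absurd (congrArg List.getLast? h) (by simpa using χ.getLast_code_ne)

theorem mem_formulaLanguage_iff {P P' : Formula → Prop} (h : ∀ φ, P φ ↔ P' φ.translate)
    (w : List Sym) : w ∈ formulaLanguage P ↔ translateString w ∈ formulaLanguage P' := by
  constructor
  · rintro ⟨φ, rfl, hφ⟩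
    exact ⟨φ.translate, (translateString_code φ).symm, (h φ).1 hφ⟩
  · rintro ⟨χ, hχ, hP⟩
    obtain ⟨φ, rfl⟩ := exists_code_of_translateString hχ
    rw [translateString_code] at hχ
    exact ⟨φ, rfl, (h φ).2 (Formula.code_injective hχ ▸ hP)⟩

end BimodalLogic

namespace LogSpace

/-! ## Paths of deterministic transition functions -/

/-- The computation that starts with `a` arrives at `b`, and `P` holds before. -/
def Run {σ : Type} (step : σ → Option σ) (P : σ → Prop) : σ → σ → Prop :=
  Relation.ReflTransGen fun x y => step x = some y ∧ P x

namespace Run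

variable {σ : Type} {step : σ → Option σ} {P : σ → Prop} {a b c : σ}

theorem refl : Run step P a a := Relation.ReflTransGen.refl

theorem trans (h : Run step P a b) (h' : Run step P b c) : Run step P a c :=
  Relation.ReflTransGen.trans h h'

theorem cons (hP : P a) (h : step a = some b) (h' : Run step P b c) : Run step P a c :=
  Relation.ReflTransGen.head ⟨h, hP⟩ h'

theorem reaches (h : Run step P a b) :
    Relation.ReflTransGen (fun x y => step x = some y) a b :=
  Relation.ReflTransGen.mono (fun _ _ h' => h'.1) _ _ h

/-- By determinism everything reachable from `a` lies on the run, which ends at `b`. `Run` itself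
says nothing about `P b`. -/
theorem forall_reaches (h : Run step P a b) (hb : step b = none) (hP : P b)
    (hc : Relation.ReflTransGen (fun x y => step x = some y) a c) : P c := by
  induction h using Relation.ReflTransGen.head_induction_on with
  | refl =>
    rcases Relation.ReflTransGen.cases_head hc with rfl | ⟨d, hd, -⟩
    · exact hP
    · simp [hb] at hd
  | head h _ ih =>
    rcases Relation.ReflTransGen.cases_head hc with rfl | ⟨d, hd, hdc⟩
    · exact h.2
    · cases h.1.symm.trans hd
      exact ih hdc

end Run

/-! ## Counter machines -/

/-- The instructions of a counter machine with `k` counters. -/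
inductive Instr (k : ℕ) (B : Type) : Type
  | out (b : B)
  | move (m : Move)
  | inc (i : Fin k)
  | dec (i : Fin k)

/-- A machine with a two-way input head, counters that can be incremented, decremented and tested
for zero, and a write-only output. In one step it executes a list of at most `N` instructions. -/
structure CounterMachine (A B : Type) where
  k : ℕ
  Q : Type
  finiteQ : Finite Q
  start : Q
  N : ℕ
  prog : Q → InCell A → (Fin k → Bool) → Option (List (Instr k B) × Q)
  length_le : ∀ q a z r, prog q a z = some r → r.1.length ≤ N

namespace CounterMachine

variable {A B : Type} (M : CounterMachine A B)

/-- Configurations of a counter machine without the state. -/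
structure Data (k : ℕ) (B : Type) where
  inPos : ℕ
  cnt : Fin k → ℕ
  out : List B

/-- The effect of an instruction on an input of length `n`. -/
def exec {k : ℕ} (n : ℕ) : Instr k B → Data k B → Data k B
  | .out b, c => { c with out := c.out ++ [b] }
  | .move m, c => { c with inPos := min (m.apply c.inPos) (n + 1) }
  | .inc i, c => { c with cnt := Function.update c.cnt i (c.cnt i + 1) }
  | .dec i, c => { c with cnt := Function.update c.cnt i (c.cnt i - 1) }

def execList {k : ℕ} (n : ℕ) (l : List (Instr k B)) (c : Data k B) : Data k B :=
  l.foldl (fun c a => exec n a c) c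

def step (w : List A) (c : M.Q × Data M.k B) : Option (M.Q × Data M.k B) :=
  (M.prog c.1 (inCell w c.2.inPos) fun i => decide (c.2.cnt i = 0)).map fun r =>
    (r.2, execList w.length r.1 c.2)

def init : M.Q × Data M.k B := (M.start, ⟨0, fun _ => 0, []⟩)

/-! ### Binary counters -/

/-- Increments a binary number, least significant bit first. -/
def incBits : List Bool → List Bool
  | [] => [true]
  | false :: l => true :: l
  | true :: l => false :: incBits l

/-- Decrements a binary number, least significant bit first, without leading zeros. -/
def decBits : List Bool → List Bool
  | [] => []
  | false :: l => true :: decBits l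
  | [true] => []
  | true :: b :: l => false :: b :: l

theorem length_incBits (l : List Bool) : (incBits l).length ≤ l.length + 1 := by
  fun_induction incBits l <;> simp_all

theorem length_decBits (l : List Bool) : (decBits l).length ≤ l.length := by
  fun_induction decBits l <;> simp_all

theorem incBits_bits (n : ℕ) : incBits n.bits = (n + 1).bits := by
  induction n using Nat.strong_induction_on with
  | _ n ih =>
    obtain ⟨m, rfl | rfl⟩ := Nat.even_or_odd' n
    · rcases Nat.eq_zero_or_pos m with rfl | hm
      · simp [incBits]
      · rw [Nat.bit0_bits m hm.ne', Nat.bit1_bits]; rfl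
    · rw [Nat.bit1_bits, show 2 * m + 1 + 1 = 2 * (m + 1) by ring, Nat.bit0_bits _ (by omega),
        incBits, ih m (by omega)]

theorem decBits_bits (n : ℕ) : decBits n.bits = (n - 1).bits := by
  induction n using Nat.strong_induction_on with
  | _ n ih =>
    obtain ⟨m, rfl | rfl⟩ := Nat.even_or_odd' n
    · rcases Nat.eq_zero_or_pos m with rfl | hm
      · simp [decBits]
      · rw [Nat.bit0_bits m hm.ne', show 2 * m - 1 = 2 * (m - 1) + 1 by omega, Nat.bit1_bits,
          decBits, ih m (by omega)]
    · rw [Nat.bit1_bits, Nat.add_sub_cancel]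
      rcases Nat.eq_zero_or_pos m with rfl | hm
      · simp [decBits]
      · rw [Nat.bit0_bits m hm.ne']
        -- Thus the last clause of `decBits` applies and not the one for `[true]`.
        have : m.bits ≠ [] := by
          rw [← List.length_pos_iff, Nat.size_eq_bits_len, Nat.size_pos]; exact hm
        obtain ⟨b, l, h⟩ := List.exists_cons_of_ne_nil this
        rw [h]; rfl

theorem length_bits_le {m n : ℕ} (h : m ≤ n + 1) : m.bits.length ≤ Nat.log 2 n + 2 := by
  rw [Nat.size_eq_bits_len, Nat.size_le]
  have := Nat.lt_pow_succ_log_self (b := 2) (by norm_num) n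
  rw [pow_succ]
  omega

/-! ### Simulation by a Turing machine -/

/-- The phases in which the Turing machine executes an instruction. -/
inductive Phase (k : ℕ) : Type
  | boot | ready | carry | peek | erase
  | back (i : Fin k)

instance : Finite Move :=
  Finite.of_surjective (fun i : Fin 3 => ![Move.left, Move.stay, Move.right] i) fun m => by
    cases m
    exacts [⟨0, rfl⟩, ⟨1, rfl⟩, ⟨2, rfl⟩]

instance {k : ℕ} [Finite B] : Finite (Instr k B) :=
  Finite.of_surjective (Sum.elim Instr.out (Sum.elim Instr.move (Sum.elim Instr.inc Instr.dec)))
    fun a => by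
      cases a with
      | out b => exact ⟨.inl b, rfl⟩
      | move m => exact ⟨.inr (.inl m), rfl⟩
      | inc i => exact ⟨.inr (.inr (.inl i)), rfl⟩
      | dec i => exact ⟨.inr (.inr (.inr i)), rfl⟩

instance {k : ℕ} : Finite (Phase k) :=
  Finite.of_surjective
    (Sum.elim (fun i : Fin 5 => ![Phase.boot, .ready, .carry, .peek, .erase] i) Phase.back)
    fun a => by
      cases a with
      | boot => exact ⟨.inl 0, rfl⟩
      | ready => exact ⟨.inl 1, rfl⟩
      | carry => exact ⟨.inl 2, rfl⟩
      | peek => exact ⟨.inl 3, rfl⟩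
      | erase => exact ⟨.inl 4, rfl⟩
      | back i => exact ⟨.inr i, rfl⟩

/-- The states of the Turing machine: the instructions to be executed, a phase and a state of the
counter machine. -/
abbrev State : Type := {l : List (Instr M.k B) // l.length ≤ M.N} × Phase M.k × M.Q

/-- Truncating the list avoids length proofs inside states; the lists in the simulated runs have
length at most `M.N` and are not changed by it. -/
def mkState (l : List (Instr M.k B)) (ph : Phase M.k) (q : M.Q) : M.State :=
  (⟨l.take M.N, List.length_take_le _ _⟩, ph, q)

/-- Writes `x` on tape `i` and moves the head there. -/
def tapeAct {k : ℕ} (γ : Fin k → Bool × Option Bool) (i : Fin k) (x : Option Bool) (m : Move) :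
    Fin k → (Bool × Option Bool) × Move :=
  fun j => if j = i then (((γ j).1, x), m) else (γ j, .stay)

/-- The transition function of the Turing machine. The cells of the work tapes hold a flag that
marks the leftmost cell and possibly a bit. -/
def trans (s : M.State) (a : InCell A) (γ : Fin M.k → Bool × Option Bool) :
    Option (M.State × Move × (Fin M.k → (Bool × Option Bool) × Move) × Option B) :=
  match s.2.1, s.1.1 with
  | .boot, l => some (M.mkState l .ready s.2.2, .stay, fun i => ((true, (γ i).2), .stay), none)
  | .ready, [] => (M.prog s.2.2 a fun i => (γ i).2.isNone).map fun r =>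
      (M.mkState r.1 .ready r.2, .stay, fun i => (γ i, .stay), none)
  | .ready, .out b :: l => some (M.mkState l .ready s.2.2, .stay, fun i => (γ i, .stay), some b)
  | .ready, .move m :: l => some (M.mkState l .ready s.2.2, m, fun i => (γ i, .stay), none)
  | .ready, l => some (M.mkState l .carry s.2.2, .stay, fun i => (γ i, .stay), none)
  | .carry, .inc i :: l =>
    if (γ i).2 = some true then
      some (M.mkState (.inc i :: l) .carry s.2.2, .stay, tapeAct γ i (some false) .right, none)
    else some (M.mkState l (.back i) s.2.2, .stay, tapeAct γ i (some true) .stay, none)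
  | .carry, .dec i :: l =>
    match (γ i).2 with
    | some false =>
      some (M.mkState (.dec i :: l) .carry s.2.2, .stay, tapeAct γ i (some true) .right, none)
    | some true =>
      some (M.mkState (.dec i :: l) .peek s.2.2, .stay, tapeAct γ i (some false) .right, none)
    | none => some (M.mkState l (.back i) s.2.2, .stay, tapeAct γ i none .stay, none)
  | .peek, .dec i :: l =>
    if (γ i).2 = none then
      some (M.mkState (.dec i :: l) .erase s.2.2, .stay, tapeAct γ i (γ i).2 .left, none)
    else some (M.mkState l (.back i) s.2.2, .stay, tapeAct γ i (γ i).2 .left, none)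
  | .erase, .dec i :: l =>
    some (M.mkState l (.back i) s.2.2, .stay, tapeAct γ i none .stay, none)
  | .back i, l =>
    if (γ i).1 then some (M.mkState l .ready s.2.2, .stay, tapeAct γ i (γ i).2 .stay, none)
    else some (M.mkState l (.back i) s.2.2, .stay, tapeAct γ i (γ i).2 .left, none)
  | _, _ => none

/-- The Turing machine that simulates a counter machine. -/
def toMachine [Finite B] : Machine A B where
  k := M.k
  Q := M.State
  finiteQ := by
    have := M.finiteQ
    have : Finite {l : List (Instr M.k B) // l.length ≤ M.N} :=
      (List.finite_length_le (Instr M.k B) M.N).to_subtype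
    infer_instance
  Γ := Bool × Option Bool
  finiteΓ := inferInstance
  blank := (false, none)
  start := M.mkState [] .boot M.start
  δ := M.trans

/-- A work tape that holds a binary number. -/
def bitTape (x : List Bool) : ℕ → Bool × Option Bool := fun j => (decide (j = 0), x[j]?)

theorem exec_inPos_le {k n : ℕ} (a : Instr k B) {c : Data k B} (hc : c.inPos ≤ n + 1) :
    (exec n a c).inPos ≤ n + 1 := by
  cases a <;> simp [exec, hc]

theorem execList_inPos_le {k n : ℕ} (l : List (Instr k B)) {c : Data k B}
    (hc : c.inPos ≤ n + 1) : (execList n l c).inPos ≤ n + 1 := by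
  induction l generalizing c with
  | nil => exact hc
  | cons a l ih => exact ih (exec_inPos_le a hc)

/-- This bounds the tapes in the middle of an instruction list, where the bound on the counters is
not available. -/
theorem length_exec_bits {k n : ℕ} (a : Instr k B) (c : Data k B) (i : Fin k) :
    ((exec n a c).cnt i).bits.length ≤ (c.cnt i).bits.length + 1 := by
  cases a with
  | out b => simp [exec]
  | move m => simp [exec]
  | inc j =>
    by_cases h : i = j
    · subst h
      simpa [exec, ← incBits_bits] using length_incBits _
    · simp [exec, h]
  | dec j =>
    by_cases h : i = j
    · subst h
      have := length_decBits (c.cnt i).bits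
      simp only [exec, Function.update_self, ← decBits_bits]
      omega
    · simp [exec, h]

variable [Finite B]

/-- A configuration of the Turing machine from its components. -/
def mkCfg (st : M.State) (p : ℕ) (τ : Fin M.k → ℕ → Bool × Option Bool) (h : Fin M.k → ℕ)
    (o : List B) : Cfg M.toMachine where
  state := st
  inPos := p
  tape := τ
  pos := h
  out := o

theorem step_mkCfg (w : List A) (st : M.State) (p : ℕ) (τ : Fin M.k → ℕ → Bool × Option Bool)
    (h : Fin M.k → ℕ) (o : List B) :
    M.toMachine.step w (M.mkCfg st p τ h o) =
      (M.trans st (inCell w p) fun i => τ i (h i)).map fun r =>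
        M.mkCfg r.1 (min (r.2.1.apply p) (w.length + 1))
          (fun i => Function.update (τ i) (h i) (r.2.2.1 i).1)
          (fun i => (r.2.2.1 i).2.apply (h i)) (o ++ r.2.2.2.toList) := rfl

/-- The configurations of the Turing machine between the execution of two instructions. -/
def readyCfg (l : List (Instr M.k B)) (q : M.Q) (c : Data M.k B) : Cfg M.toMachine :=
  M.mkCfg (M.mkState l .ready q) c.inPos (fun i => bitTape (c.cnt i).bits) (fun _ => 0) c.out

/-- The configurations of the Turing machine during the execution of an instruction for counter
`i`: the head of tape `i` stands on cell `j`, and tape `i` holds the bits `x`. -/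
def busyCfg (l : List (Instr M.k B)) (ph : Phase M.k) (q : M.Q) (c : Data M.k B) (i : Fin M.k)
    (x : List Bool) (j : ℕ) : Cfg M.toMachine :=
  M.mkCfg (M.mkState l ph q) c.inPos
    (Function.update (fun i => bitTape (c.cnt i).bits) i (bitTape x))
    (Function.update (fun _ => 0) i j) c.out

/-- All heads of the work tapes stand on the first `s` cells. -/
def InSpace (s : ℕ) (c : Cfg M.toMachine) : Prop := ∀ i, c.pos i < s

theorem inSpace_mkCfg {s : ℕ} {st : M.State} {p : ℕ} {τ : Fin M.k → ℕ → Bool × Option Bool}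
    {h : Fin M.k → ℕ} {o : List B} (hh : ∀ i, h i < s) : M.InSpace s (M.mkCfg st p τ h o) := hh

theorem inSpace_busyCfg {s : ℕ} {l : List (Instr M.k B)} {ph : Phase M.k} {q : M.Q}
    {c : Data M.k B} {i : Fin M.k} {x : List Bool} {j : ℕ} (h : j < s) :
    M.InSpace s (M.busyCfg l ph q c i x j) := by
  refine M.inSpace_mkCfg fun i' => ?_
  rw [Function.update_apply]
  split_ifs <;> omega

/-- Reduces a step that acts on tape `i` alone to the transition for the scanned cell and a cellwise
description of the new bits; `y = none` erases a cell. -/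
theorem step_busyCfg {w : List A} {l l' : List (Instr M.k B)} {ph ph' : Phase M.k} {q : M.Q}
    {c : Data M.k B} {i : Fin M.k} {x x' : List Bool} {j : ℕ} {y : Option Bool} (m : Move) {j' : ℕ}
    (hj' : m.apply j = j') (hc : c.inPos ≤ w.length + 1)
    (h : ∀ a γ, γ i = (decide (j = 0), x[j]?) →
      M.trans (M.mkState l ph q) a γ = some (M.mkState l' ph' q, .stay, tapeAct γ i y m, none))
    (hx : ∀ n, x'[n]? = if n = j then y else x[n]?) :
    M.toMachine.step w (M.busyCfg l ph q c i x j) = some (M.busyCfg l' ph' q c i x' j') := by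
  subst hj'
  rw [busyCfg, step_mkCfg, h _ _ (by simp [bitTape]), Option.map_some, busyCfg, Option.some_inj]
  congr 1
  · simpa [Move.apply] using hc
  · funext i' n
    by_cases hi : i' = i
    · subst hi
      simp only [tapeAct, Function.update_self, bitTape, if_pos, hx, Function.update_apply]
      split_ifs with hj <;> simp [hj]
    · simp [tapeAct, hi]
  · funext i'
    by_cases hi : i' = i
    · subst hi
      simp [tapeAct]
    · simp [tapeAct, hi, Move.apply]
  · simp

theorem busyCfg_update (l : List (Instr M.k B)) (q : M.Q) (c : Data M.k B) (i : Fin M.k) (n : ℕ) :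
    M.busyCfg l .ready q c i n.bits 0 =
      M.readyCfg l q { c with cnt := Function.update c.cnt i n } := by
  rw [busyCfg, readyCfg]
  congr 1
  · funext i'
    by_cases hi : i' = i
    · subst hi; simp
    · simp [hi]
  · exact Function.update_eq_self i (fun _ => 0)

/-! ### Runs of the simulating machine -/

section

variable {w : List A} {l : List (Instr M.k B)} {q : M.Q} {c : Data M.k B} {i : Fin M.k} {s : ℕ}

theorem run_back (hc : c.inPos ≤ w.length + 1) (hl : l.length ≤ M.N) (x : List Bool) (j : ℕ)
    (hs : j < s) :
    Run (M.toMachine.step w) (M.InSpace s) (M.busyCfg l (.back i) q c i x j)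
      (M.busyCfg l .ready q c i x 0) := by
  induction j with
  | zero =>
    refine .cons (M.inSpace_busyCfg hs) (M.step_busyCfg .stay rfl (y := x[0]?) (x' := x) hc
      (fun a γ hγ => ?_) (fun j' => ?_)) .refl
    · simp [trans, mkState, hγ, List.take_of_length_le hl]
    · split_ifs with h <;> simp [h]
  | succ j ih =>
    refine .cons (M.inSpace_busyCfg hs) (M.step_busyCfg .left rfl (y := x[j + 1]?) (x' := x) hc
      (fun a γ hγ => ?_) (fun j' => ?_)) (ih (by omega))
    · simp [trans, mkState, hγ, List.take_of_length_le hl]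
    · split_ifs with h <;> simp [h]

/-- Here `u` holds the bits that the carry has passed, and the head stands on the first bit of `v`,
or on the blank cell behind the number. -/
theorem run_inc (hc : c.inPos ≤ w.length + 1) (hl : l.length + 1 ≤ M.N) (u v : List Bool)
    (hs : u.length + v.length < s) :
    Run (M.toMachine.step w) (M.InSpace s)
      (M.busyCfg (.inc i :: l) .carry q c i (u ++ v) u.length)
      (M.busyCfg l .ready q c i (u ++ incBits v) 0) := by
  have htake : (Instr.inc i :: l).take M.N = Instr.inc i :: l := List.take_of_length_le hl
  induction v generalizing u with
  | nil =>
    refine .cons (M.inSpace_busyCfg (by omega)) (M.step_busyCfg .stay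
      (j' := u.length) rfl (y := some true) hc (fun a γ hγ => ?_) (fun j' => ?_))
      (M.run_back hc (by omega) (u ++ [true]) _ (by omega))
    · simp [trans, mkState, hγ, htake]
    · grind
  | cons b v ih =>
    have hs' : u.length + v.length + 1 < s := by simpa [add_assoc] using hs
    cases b
    · refine .cons (M.inSpace_busyCfg (by omega)) (M.step_busyCfg .stay
        (j' := u.length) rfl (y := some true) hc (fun a γ hγ => ?_) (fun j' => ?_))
        (M.run_back hc (by omega) (u ++ true :: v) _ (by omega))
      · simp [trans, mkState, hγ, htake]
      · grind
    · have ih := ih (u ++ [false]) (by simp; omega)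
      simp only [List.append_assoc, List.length_append, List.singleton_append, List.length_cons,
        List.length_nil] at ih
      refine .cons (M.inSpace_busyCfg (by omega)) (M.step_busyCfg .right rfl (y := some false) hc
        (fun a γ hγ => ?_) (fun j' => ?_)) ih
      · simp [trans, mkState, hγ, htake]
      · grind

theorem run_dec (hc : c.inPos ≤ w.length + 1) (hl : l.length + 1 ≤ M.N) (u v : List Bool)
    (hs : u.length + v.length < s) :
    Run (M.toMachine.step w) (M.InSpace s)
      (M.busyCfg (.dec i :: l) .carry q c i (u ++ v) u.length)
      (M.busyCfg l .ready q c i (u ++ decBits v) 0) := by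
  have htake : (Instr.dec i :: l).take M.N = Instr.dec i :: l := List.take_of_length_le hl
  induction v generalizing u with
  | nil =>
    refine .cons (M.inSpace_busyCfg (by omega)) (M.step_busyCfg .stay
      (j' := u.length) rfl (y := none) hc (fun a γ hγ => ?_) (fun j' => ?_))
      (M.run_back hc (by omega) (u ++ []) _ (by omega))
    · simp [trans, mkState, hγ, htake]
    · grind
  | cons b v ih =>
    have hs' : u.length + v.length + 1 < s := by simpa [add_assoc] using hs
    cases b
    · have ih := ih (u ++ [true]) (by simp; omega)
      simp only [List.append_assoc, List.length_append, List.singleton_append, List.length_cons,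
        List.length_nil] at ih
      refine .cons (M.inSpace_busyCfg (by omega)) (M.step_busyCfg .right rfl (y := some true) hc
        (fun a γ hγ => ?_) (fun j' => ?_)) ih
      · simp [trans, mkState, hγ, htake]
      · grind
    -- The borrow ends at a one, which becomes zero. If the next cell is blank, this was the top bit
    -- and has to be erased, since leading zeros would spoil the zero test.
    · cases v with
      | nil =>
        refine .cons (M.inSpace_busyCfg (by omega)) (M.step_busyCfg .right rfl
          (l' := .dec i :: l) (ph' := .peek) (x' := u ++ [false]) (y := some false) hc
          (fun a γ hγ => ?_) (fun j' => ?_)) <| .cons (M.inSpace_busyCfg hs')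
          (M.step_busyCfg .left rfl
          (l' := .dec i :: l) (ph' := .erase) (x' := u ++ [false]) (y := none) hc
          (fun a γ hγ => ?_) (fun j' => ?_)) <| .cons (M.inSpace_busyCfg (Nat.lt_of_succ_lt hs'))
          (M.step_busyCfg .stay (j' := u.length) rfl
          (l' := l) (ph' := .back i) (x' := u ++ []) (y := none) hc
          (fun a γ hγ => ?_) (fun j' => ?_))
          (M.run_back hc (by omega) (u ++ []) _ (Nat.lt_of_succ_lt hs'))
        · simp [trans, mkState, hγ, htake]
        · grind
        · simp [trans, mkState, hγ, htake, Move.apply]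
        · simp only [Move.apply]; grind
        · simp [trans, mkState, htake]
        · simp only [Move.apply]; grind
      | cons b v =>
        have hb : (u ++ false :: b :: v)[u.length + 1]? = some b := by simp
        refine .cons (M.inSpace_busyCfg (by omega)) (M.step_busyCfg .right rfl
          (l' := .dec i :: l) (ph' := .peek) (x' := u ++ false :: b :: v) (y := some false) hc
          (fun a γ hγ => ?_) (fun j' => ?_)) <| .cons (M.inSpace_busyCfg (by
            simp only [Move.apply]; omega))
          (M.step_busyCfg .left rfl
          (l' := l) (ph' := .back i) (x' := u ++ false :: b :: v) (y := some b) hc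
          (fun a γ hγ => ?_) (fun j' => ?_))
          (M.run_back hc (by omega) _ _ (by simp only [Move.apply]; omega))
        · simp [trans, mkState, hγ, htake]
        · grind
        · simp [trans, mkState, hγ, htake, Move.apply]
        · simp only [Move.apply]; grind

theorem inSpace_readyCfg (hs : 0 < s) : M.InSpace s (M.readyCfg l q c) := fun _ => hs

theorem step_readyCfg_carry (hc : c.inPos ≤ w.length + 1) {a : Instr M.k B}
    (ha : a = .inc i ∨ a = .dec i) (hl : l.length + 1 ≤ M.N) :
    M.toMachine.step w (M.readyCfg (a :: l) q c) =
      some (M.busyCfg (a :: l) .carry q c i (c.cnt i).bits 0) := by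
  have htake : (a :: l).take M.N = a :: l := List.take_of_length_le hl
  have h : ∀ a' γ, M.trans (M.mkState (a :: l) .ready q) a' γ =
      some (M.mkState (a :: l) .carry q, .stay, fun i => (γ i, .stay), none) := by
    intro a' γ
    rcases ha with rfl | rfl <;> simp [trans, mkState, htake]
  rw [readyCfg, step_mkCfg, h, Option.map_some, busyCfg]
  simp [Move.apply, hc, Function.update_eq_self]

theorem run_instr (hc : c.inPos ≤ w.length + 1) (a : Instr M.k B) (hl : l.length + 1 ≤ M.N)
    (hs : ∀ i, (c.cnt i).bits.length < s) (hs' : 0 < s) :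
    Run (M.toMachine.step w) (M.InSpace s) (M.readyCfg (a :: l) q c)
      (M.readyCfg l q (exec w.length a c)) := by
  have htake : (a :: l).take M.N = a :: l := List.take_of_length_le hl
  cases a with
  | out b =>
    refine .cons (M.inSpace_readyCfg hs') ?_ .refl
    have h : ∀ a' γ, M.trans (M.mkState (.out b :: l) .ready q) a' γ =
        some (M.mkState l .ready q, .stay, fun i => (γ i, .stay), some b) := by
      intro a' γ
      simp [trans, mkState, htake]
    rw [readyCfg, step_mkCfg, h, Option.map_some, readyCfg]
    simp [Move.apply, hc, exec]
  | move m =>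
    refine .cons (M.inSpace_readyCfg hs') ?_ .refl
    have h : ∀ a' γ, M.trans (M.mkState (.move m :: l) .ready q) a' γ =
        some (M.mkState l .ready q, m, fun i => (γ i, .stay), none) := by
      intro a' γ
      simp [trans, mkState, htake]
    rw [readyCfg, step_mkCfg, h, Option.map_some, readyCfg]
    simp [Move.apply, exec]
  | inc i =>
    refine .cons (M.inSpace_readyCfg hs') (M.step_readyCfg_carry hc (.inl rfl) hl) ?_
    have := M.run_inc (q := q) (i := i) hc hl [] (c.cnt i).bits (by simpa using hs i)
    rwa [List.nil_append, List.nil_append, incBits_bits, busyCfg_update] at this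
  | dec i =>
    refine .cons (M.inSpace_readyCfg hs') (M.step_readyCfg_carry hc (.inr rfl) hl) ?_
    have := M.run_dec (q := q) (i := i) hc hl [] (c.cnt i).bits (by simpa using hs i)
    rwa [List.nil_append, List.nil_append, decBits_bits, busyCfg_update] at this

theorem run_execList (hc : c.inPos ≤ w.length + 1) (hl : l.length ≤ M.N)
    (hs : ∀ i, (c.cnt i).bits.length + l.length < s) (hs' : 0 < s) :
    Run (M.toMachine.step w) (M.InSpace s) (M.readyCfg l q c)
      (M.readyCfg [] q (execList w.length l c)) := by
  induction l generalizing c with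
  | nil => exact .refl
  | cons a l ih =>
    simp only [List.length_cons] at hl hs
    refine (M.run_instr hc a hl (fun i => by have := hs i; omega) hs').trans
      (ih (exec_inPos_le a hc) (by omega) fun i => ?_)
    have := length_exec_bits (n := w.length) a c i
    have := hs i
    omega

theorem step_readyCfg (hc : c.inPos ≤ w.length + 1) : M.toMachine.step w (M.readyCfg [] q c) =
    (M.prog q (inCell w c.inPos) fun i => decide (c.cnt i = 0)).map fun r =>
      M.readyCfg r.1 r.2 c := by
  -- Without leading zeros, only the number zero leaves the first cell blank.
  have hz : ∀ i, (bitTape (c.cnt i).bits 0).2.isNone = decide (c.cnt i = 0) := by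
    intro i
    rw [Bool.eq_iff_iff]
    simp [bitTape, Nat.size_eq_bits_len, Nat.size_eq_zero]
  have h : ∀ a' γ, M.trans (M.mkState [] .ready q) a' γ =
      (M.prog q a' fun i => (γ i).2.isNone).map fun r =>
      (M.mkState r.1 .ready r.2, .stay, fun i => (γ i, .stay), none) := by
    intro a' γ
    simp [trans, mkState]
  rw [readyCfg, step_mkCfg, h]
  simp only [hz, Option.map_map]
  congr 1
  funext r
  simp [Move.apply, readyCfg, hc]

end

/-- The counters hold numbers up to `n + 1`. -/
def Bounded (n : ℕ) (c : M.Q × Data M.k B) : Prop := ∀ i, c.2.cnt i ≤ n + 1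

theorem run_toMachine {w : List A} {a b : M.Q × Data M.k B} {s : ℕ}
    (hs : Nat.log 2 w.length + 2 + M.N < s) (ha : a.2.inPos ≤ w.length + 1)
    (h : Run (M.step w) (M.Bounded w.length) a b) :
    Run (M.toMachine.step w) (M.InSpace s) (M.readyCfg [] a.1 a.2) (M.readyCfg [] b.1 b.2) := by
  induction h using Relation.ReflTransGen.head_induction_on with
  | refl => exact .refl
  | @head a c h _ ih =>
    obtain ⟨h, hb⟩ := h
    simp only [step, Option.map_eq_some_iff] at h
    obtain ⟨r, hr, rfl⟩ := h
    refine .cons (M.inSpace_readyCfg (by omega)) ?_ ((M.run_execList (l := r.1) (q := r.2) ha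
      (M.length_le _ _ _ _ hr) (fun i => ?_) (by omega)).trans (ih (execList_inPos_le _ ha)))
    · rw [M.step_readyCfg ha, hr, Option.map_some]
    · have := length_bits_le (hb i)
      have := M.length_le _ _ _ _ hr
      omega

/-- A function is computable in logarithmic space if it is computed by a counter machine whose
counters are bounded by the length of the input. -/
theorem computable {f : List A → List B}
    (hf : ∀ w, ∃ c, Run (M.step w) (M.Bounded w.length) M.init c ∧ M.step w c = none ∧
      c.2.out = f w) : Computable f := by
  refine ⟨M.toMachine, M.N + 3, fun w => ?_⟩
  obtain ⟨c, hc, hnext, hout⟩ := hf w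
  -- A counter has at most `log n + 2` bits before a list of instructions and gains at most `M.N`
  -- bits during it.
  set s := (M.N + 3) * (Nat.log 2 w.length + 1)
  have hs : Nat.log 2 w.length + 2 + M.N < s := by
    have : s = M.N * Nat.log 2 w.length + M.N + 3 * Nat.log 2 w.length + 3 := by
      simp only [s]; ring
    have := Nat.zero_le (M.N * Nat.log 2 w.length)
    omega
  -- Initially no cell carries the flag; the boot step sets it on cell `0` of each tape.
  have hboot : M.toMachine.step w M.toMachine.init = some (M.readyCfg [] M.start M.init.2) := by
    change M.toMachine.step w (M.mkCfg (M.mkState [] .boot M.start) 0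
      (fun _ _ => (false, none)) (fun _ => 0) []) = _
    rw [step_mkCfg, readyCfg]
    simp only [trans, mkState, Option.map_some, Option.some_inj, init, List.take_nil]
    congr 1
    funext i j
    simp only [Function.update_apply, bitTape]
    split_ifs with h <;> simp [h]
  have hpos : c.2.inPos ≤ w.length + 1 := by
    clear hnext hout
    induction hc with
    | refl => exact Nat.zero_le _
    | tail _ h ih =>
      simp only [step, Option.map_eq_some_iff] at h
      obtain ⟨⟨r, -, rfl⟩, -⟩ := h
      exact execList_inPos_le _ ih
  have hpath : Run (M.toMachine.step w) (M.InSpace s) M.toMachine.init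
      (M.readyCfg [] c.1 c.2) :=
    .cons (fun _ => by show 0 < s; omega) hboot (M.run_toMachine hs (Nat.zero_le _) hc)
  have hnone : M.toMachine.step w (M.readyCfg [] c.1 c.2) = none := by
    rw [M.step_readyCfg hpos]
    simpa [step] using hnext
  exact ⟨⟨_, hpath.reaches, hnone, hout⟩, fun c' hc' =>
    hpath.forall_reaches hnone (M.inSpace_readyCfg (by omega)) hc'⟩

end CounterMachine

end LogSpace

namespace BimodalLogic

open LogSpace LogSpace.CounterMachine

/-! ## A counter machine for the translation -/

theorem length_scan_le (m : Bool) (d : ℕ) (s : List Sym) : (scan m d s).length ≤ s.length := by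
  induction s generalizing m d with
  | nil => simp [scan]
  | cons c s ih =>
    rw [scan]
    split
    · simp
    · simpa using ih _ _

/-- What the scanner sees when it stops. -/
theorem exists_eq_scan_append (m : Bool) (d : ℕ) (s : List Sym) :
    ∃ r, s = scan m d s ++ r ∧ (r = [] ∨ ∃ c r', r = c :: r' ∧
      scanStep (scanEnd m d s).1 (decide ((scanEnd m d s).2 = 0)) c = none) := by
  induction s generalizing m d with
  | nil => exact ⟨[], rfl, .inl rfl⟩
  | cons c s ih =>
    rw [scan, scanEnd]
    split
    · exact ⟨c :: s, rfl, .inr ⟨c, s, rfl, by assumption⟩⟩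
    · obtain ⟨r, hr, h⟩ := ih _ _
      exact ⟨r, congrArg _ hr, h⟩

/-- The passes over (parts of) the input: one that counts the occurrences of `□`, one that copies
the whole input, and four that copy the subformula behind an occurrence of `□`. -/
inductive Pass : Type
  | count | whole | first | second | third | fourth
  deriving DecidableEq

/-- The states of the machine. In the state `reset t` it walks back to where pass `t` started. -/
inductive TState : Type
  | count
  | copy (t : Pass) (m : Bool)
  | reset (t : Pass)
  | loop
  | halt

instance : Finite Pass :=
  Finite.of_surjective
    (fun i : Fin 6 => ![Pass.count, .whole, .first, .second, .third, .fourth] i) fun t => by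
    cases t
    exacts [⟨0, rfl⟩, ⟨1, rfl⟩, ⟨2, rfl⟩, ⟨3, rfl⟩, ⟨4, rfl⟩, ⟨5, rfl⟩]

instance : Finite TState :=
  Finite.of_surjective
    (Sum.elim (fun i : Fin 3 => ![TState.count, .loop, .halt] i)
      (Sum.elim (fun p : Pass × Bool => TState.copy p.1 p.2) TState.reset)) fun q => by
    cases q with
    | count => exact ⟨.inl 0, rfl⟩
    | loop => exact ⟨.inl 1, rfl⟩
    | halt => exact ⟨.inl 2, rfl⟩
    | copy t m => exact ⟨.inr (.inl (t, m)), rfl⟩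
    | reset t => exact ⟨.inr (.inr t), rfl⟩

instance : Finite Sym :=
  Finite.of_surjective (fun i : Fin 9 => ![Sym.lparen, .rparen, .neg, .box, .know, .conj, .x,
    .zero, .one] i) fun c => by
    cases c
    exacts [⟨0, rfl⟩, ⟨1, rfl⟩, ⟨2, rfl⟩, ⟨3, rfl⟩, ⟨4, rfl⟩, ⟨5, rfl⟩,
      ⟨6, rfl⟩, ⟨7, rfl⟩, ⟨8, rfl⟩]

def DepthOp.instrs : DepthOp → List (Instr 2 Sym)
  | inc => [.inc 0]
  | dec => [.dec 0]
  | nop => []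

/-- What is written after a pass, and the state in which the machine goes on. -/
def Pass.next : Pass → List Sym × TState
  | count => ([], .copy .whole false)
  | whole => ([], .loop)
  | first => ([.conj, .neg], .copy .second false)
  | second => ([.rparen, .conj, .box, .neg, .lparen, .box], .copy .third false)
  | third => ([.conj, .neg], .copy .fourth false)
  | fourth => ([.rparen, .rparen, .rparen], .loop)

/-- The program. Counter `0` holds the number of open parentheses, counter `1` the number of letters
that were read in the current pass. -/
def translateProg (q : TState) (a : InCell Sym) (z : Fin 2 → Bool) :
    Option (List (Instr 2 Sym) × TState) :=
  match q, a with
  | .count, .leftEnd => some ([.move .right], .count)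
  | .count, .letter c =>
    some ((if c = .box then [.out .lparen] else []) ++ [.inc 1, .move .right], .count)
  | .count, .rightEnd => some ([], .reset .count)
  | .copy _ _, .leftEnd => none
  | .copy t m, .letter c =>
    match scanStep m (z 0) c with
    | some (m', o) => some (.out c :: (o.instrs ++ [.inc 1, .move .right]), .copy t m')
    | none => if t = .whole then some ([.out .neg], .halt) else some ([], .reset t)
  | .copy t m, .rightEnd =>
    if t = .whole ∧ ¬ (m ∧ z 0) then some ([.out .neg], .halt) else some ([], .reset t)
  | .reset t, _ =>
    if z 0 = false then some ([.dec 0], .reset t)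
    else if z 1 = false then some ([.dec 1, .move .left], .reset t)
    else some (t.next.1.map .out, t.next.2)
  | .loop, .letter .box =>
    some ([Sym.conj, .know, .lparen, .neg, .lparen, .box].map .out ++ [.move .right],
      .copy .first false)
  | .loop, .letter _ => some ([.move .right], .loop)
  | .loop, _ => none
  | .halt, _ => none

def translateMachine : CounterMachine Sym Sym where
  k := 2
  Q := TState
  finiteQ := inferInstance
  start := .count
  -- The longest list is executed in `loop` on a `□`: six letters and a head move.
  N := 7
  prog := translateProg
  length_le := by
    intro q a z r h
    unfold translateProg at h
    split at h
    · cases h; simp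
    · cases h; split_ifs <;> simp
    · cases h; simp
    · cases h
    · split at h
      · rename_i o _
        cases h; cases o <;> simp [DepthOp.instrs]
      · split_ifs at h <;> cases h <;> simp
    · split_ifs at h <;> cases h <;> simp
    · split_ifs at h <;> cases h
      · simp
      · simp
      · rename_i t _ _
        cases t <;> simp [Pass.next]
    · cases h; simp
    · cases h; simp
    · cases h
    · cases h

/-- Configurations: state, position of the input head, counters and output. -/
def conf (q : TState) (p d e : ℕ) (o : List Sym) :
    translateMachine.Q × Data translateMachine.k Sym :=
  (q, ⟨p, ![d, e], o⟩)

theorem bounded_conf {n : ℕ} {q : TState} {p d e : ℕ} {o : List Sym} (hd : d ≤ n + 1)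
    (he : e ≤ n + 1) : translateMachine.Bounded n (conf q p d e o) := by
  have : ∀ i : Fin 2, ![d, e] i ≤ n + 1 := by
    rw [Fin.forall_fin_two]
    exact ⟨hd, he⟩
  exact this

/-- The computations of the machine. -/
abbrev TRun (w : List Sym) := Run (translateMachine.step w) (translateMachine.Bounded w.length)

theorem update_zero (d e x : ℕ) : Function.update ![d, e] 0 x = ![x, e] := by
  ext i; fin_cases i <;> rfl

theorem update_one (d e x : ℕ) : Function.update ![d, e] 1 x = ![d, x] := by
  ext i; fin_cases i <;> rfl

theorem step_conf (w : List Sym) (q : TState) (p d e : ℕ) (o : List Sym) :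
    translateMachine.step w (conf q p d e o) =
      (translateProg q (inCell w p) fun i => decide (![d, e] i = 0)).map fun r =>
        (r.2, execList w.length r.1 ⟨p, ![d, e], o⟩) := rfl

theorem run_cons {w : List Sym} {q : TState} {p d e : ℕ} {o : List Sym} {q' : TState}
    {p' d' e' : ℕ} {o' : List Sym} {c : translateMachine.Q × Data translateMachine.k Sym}
    (l : List (Instr 2 Sym)) (hd : d ≤ w.length + 1) (he : e ≤ w.length + 1)
    (h : translateProg q (inCell w p) ![decide (d = 0), decide (e = 0)] = some (l, q'))
    (hl : execList w.length l ⟨p, ![d, e], o⟩ = ⟨p', ![d', e'], o'⟩)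
    (h' : TRun w (conf q' p' d' e' o') c) : TRun w (conf q p d e o) c := by
  refine .cons (bounded_conf hd he) ?_ h'
  have hz : (fun i => decide (![d, e] i = 0)) = ![decide (d = 0), decide (e = 0)] := by
    ext i; fin_cases i <;> rfl
  rw [step_conf, hz, h, Option.map_some, hl]
  rfl

theorem execList_map_out (n p : ℕ) (f : Fin 2 → ℕ) (o s : List Sym) :
    execList n (s.map .out) ⟨p, f, o⟩ = ⟨p, f, o ++ s⟩ := by
  induction s generalizing o with
  | nil => simp [execList]
  | cons c s ih =>
    have := ih (o ++ [c])
    simp only [execList, List.map_cons, List.foldl_cons, exec] at this ⊢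
    simp [this]

theorem inCell_append_cons (u : List Sym) (c : Sym) (s : List Sym) :
    inCell (u ++ c :: s) (u.length + 1) = .letter c := by
  simp [inCell]

theorem inCell_length (w : List Sym) : inCell w (w.length + 1) = .rightEnd := by
  simp [inCell]

/-! ### The passes of the translation machine -/

theorem run_reset {w : List Sym} (t : Pass) (d e p : ℕ) (o : List Sym) (hd : d ≤ w.length + 1)
    (he : p + e ≤ w.length + 1) :
    TRun w (conf (.reset t) (p + e) d e o) (conf (.reset t) p 0 0 o) := by
  induction d with
  | zero =>
    induction e with
    | zero => exact .refl
    | succ e ih =>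
      refine run_cons [.dec 1, .move .left] hd (by omega) (by simp [translateProg]) ?_
        (ih (by omega))
      simp [execList, exec, update_one, Move.apply]
      omega
  | succ d ih =>
    refine run_cons [.dec 0] hd (by omega) (by simp [translateProg]) ?_ (ih (by omega))
    simp [execList, exec, update_zero]

theorem run_next {w : List Sym} (t : Pass) (p : ℕ) (o : List Sym) :
    TRun w (conf (.reset t) p 0 0 o) (conf t.next.2 p 0 0 (o ++ t.next.1)) :=
  run_cons (t.next.1.map .out) (Nat.zero_le _) (Nat.zero_le _) (by simp [translateProg])
    (execList_map_out _ _ _ _ _) .refl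

/-- A pass that has reached cell `p + e` ends in cell `p`. -/
theorem run_reset_next {w : List Sym} (t : Pass) {d e p p' : ℕ} (o : List Sym)
    (hd : d ≤ w.length + 1) (hp : p' = p + e) (he : p + e ≤ w.length + 1) :
    TRun w (conf (.reset t) p' d e o) (conf t.next.2 p 0 0 (o ++ t.next.1)) :=
  hp ▸ (run_reset t d e p o hd he).trans (run_next t p o)

theorem run_count {w u s : List Sym} (hw : w = u ++ s) (o : List Sym) :
    TRun w (conf .count (u.length + 1) 0 u.length o)
      (conf (.copy .whole false) 1 0 0 (o ++ List.replicate (s.count .box) .lparen)) := by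
  induction s generalizing u o with
  | nil =>
    rw [List.append_nil] at hw
    subst hw
    have h := run_reset_next (w := w) .count (d := 0) (e := w.length) (p := 1) o (Nat.zero_le _)
      (add_comm _ _) (by omega)
    exact run_cons [] (Nat.zero_le _) (by omega) (by rw [inCell_length]; rfl) rfl h
  | cons c s ih =>
    have hlen : w.length = u.length + s.length + 1 := by simp [hw, add_assoc]
    have h := ih (u := u ++ [c]) (by simp [hw]) (if c = .box then o ++ [.lparen] else o)
    have ho : (if c = .box then o ++ [.lparen] else o) ++
        List.replicate (s.count Sym.box) Sym.lparen =
        o ++ List.replicate ((c :: s).count Sym.box) Sym.lparen := by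
      by_cases hc : c = .box <;> simp [hc, List.replicate_succ]
    rw [List.length_append, List.length_singleton, ho] at h
    refine run_cons _ (Nat.zero_le _) (by omega)
      (by rw [hw, inCell_append_cons, translateProg]) ?_ h
    split_ifs <;> simp [execList, exec, update_one, Move.apply] <;> omega

/-- A letter opens at most one parenthesis, so the depth never exceeds the number of letters read;
this keeps counter `0` within the input length. -/
theorem run_copy {w u s : List Sym} (hw : w = u ++ s) (t : Pass) (m : Bool) {d e : ℕ}
    (hd : d ≤ e) (he : e ≤ u.length) (o : List Sym) :
    TRun w (conf (.copy t m) (u.length + 1) d e o)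
      (conf (.copy t (scanEnd m d s).1) (u.length + 1 + (scan m d s).length) (scanEnd m d s).2
        (e + (scan m d s).length) (o ++ scan m d s)) ∧
      (scanEnd m d s).2 ≤ e + (scan m d s).length := by
  induction s generalizing u m d e o with
  | nil => simpa [scan, scanEnd, hd] using LogSpace.Run.refl
  | cons c s ih =>
    rw [scan, scanEnd]
    split
    · simpa [hd] using LogSpace.Run.refl
    · rename_i m' op hop
      have hlen : w.length = u.length + s.length + 1 := by simp [hw, add_assoc]
      have hd' : op.apply d ≤ e + 1 := by cases op <;> simp only [DepthOp.apply] <;> omega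
      obtain ⟨h, hle⟩ := ih (u := u ++ [c]) (by simp [hw]) m' hd' (by simpa using he) (o ++ [c])
      rw [List.length_append, List.length_singleton] at h
      have h₁ : u.length + 1 + (c :: scan m' (op.apply d) s).length =
          u.length + 1 + 1 + (scan m' (op.apply d) s).length := by
        rw [List.length_cons]; omega
      have h₂ : e + (c :: scan m' (op.apply d) s).length =
          e + 1 + (scan m' (op.apply d) s).length := by
        rw [List.length_cons]; omega
      rw [h₁, h₂, List.append_cons]
      refine ⟨run_cons (.out c :: (op.instrs ++ [.inc 1, .move .right])) (by omega) (by omega)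
        (by rw [hw, inCell_append_cons]; simp [translateProg, hop]) ?_ h, hle⟩
      cases op <;> simp [execList, exec, update_zero, update_one, Move.apply, DepthOp.instrs,
        DepthOp.apply] <;> omega

/-- The machine copies a subformula and walks back. -/
theorem run_copy_reset {w u s : List Sym} (hw : w = u ++ s) {t : Pass} (ht : t ≠ .whole)
    (o : List Sym) :
    TRun w (conf (.copy t false) (u.length + 1) 0 0 o)
      (conf t.next.2 (u.length + 1) 0 0 (o ++ scan false 0 s ++ t.next.1)) := by
  obtain ⟨h, hle⟩ := run_copy hw t false le_rfl (Nat.zero_le _) o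
  have hs := length_scan_le false 0 s
  have hlen : w.length = u.length + s.length := by simp [hw]
  refine h.trans (run_cons [] (by omega) (by omega) ?_ rfl
    (run_reset_next t _ (by omega) (by omega) (by omega)))
  rw [add_right_comm, ← List.length_append]
  -- The scanner stops at the end of the input or in front of a letter; in a pass other than `whole`
  -- both lead to `reset`.
  obtain ⟨r, hr, rfl | ⟨c, r', rfl, hc⟩⟩ := exists_eq_scan_append false 0 s
  · have : w = u ++ scan false 0 s := by rw [hw, ← hr.trans (List.append_nil _)]
    rw [← this, inCell_length]
    simp [translateProg, ht]
  · have : w = (u ++ scan false 0 s) ++ c :: r' := by rw [List.append_assoc, ← hr, hw]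
    rw [this, inCell_append_cons]
    simp [translateProg, hc, ht]

theorem run_copy_whole {w : List Sym} (hw : ScanOk w) (o : List Sym) :
    TRun w (conf (.copy .whole false) 1 0 0 o) (conf .loop 1 0 0 (o ++ w)) := by
  obtain ⟨h, -⟩ := run_copy (w := w) (u := []) (s := w) (d := 0) (e := 0) rfl .whole false le_rfl
    le_rfl o
  rw [hw.1, hw.2] at h
  have h' := run_reset_next (w := w) .whole (d := 0) (e := w.length) (p := 1) (o ++ w)
    (Nat.zero_le _) (add_comm _ _) (by omega)
  rw [Pass.next, List.append_nil] at h'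
  refine h.trans (run_cons [] (Nat.zero_le _) (by omega) ?_ ?_ h')
  · rw [List.length_nil, Nat.zero_add, add_comm 1, inCell_length]
    simp [translateProg]
  · simp [execList, add_comm]

/-- When the scanner fails, the letters read so far are already on the write-only tape, so the
output is spoiled by a final `¬`. -/
theorem run_copy_whole_of_not {w : List Sym} (hw : ¬ ScanOk w) (o : List Sym) :
    ∃ p d e, TRun w (conf (.copy .whole false) 1 0 0 o)
      (conf .halt p d e (o ++ scan false 0 w ++ [.neg])) := by
  obtain ⟨h, hle⟩ := run_copy (w := w) (u := []) (s := w) (d := 0) (e := 0) rfl .whole false le_rfl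
    le_rfl o
  have hs := length_scan_le false 0 w
  refine ⟨_, _, _, h.trans (run_cons [.out .neg] (by omega) (by omega) ?_ rfl .refl)⟩
  rw [List.length_nil, Nat.zero_add, add_comm 1]
  obtain ⟨r, hr, rfl | ⟨c, r', rfl, hc⟩⟩ := exists_eq_scan_append false 0 w
  · rw [List.append_nil] at hr
    have : ¬ ((scanEnd false 0 w).1 = true ∧ (scanEnd false 0 w).2 = 0) := fun h =>
      hw ⟨hr.symm, Prod.ext h.1 h.2⟩
    rw [← hr, inCell_length]
    simpa [translateProg] using this
  · have := inCell_append_cons (scan false 0 w) c r'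
    rw [← hr] at this
    rw [this]
    simp [translateProg, hc]

/-- Each of the four copying passes returns to the cell behind the `□`. The search resumes there, so
that nested boxes are found as well. -/
theorem run_block {w u s : List Sym} (hw : w = u ++ Sym.box :: s) (o : List Sym) :
    TRun w (conf .loop (u.length + 1) 0 0 o)
      (conf .loop (u.length + 2) 0 0 (o ++ reflBlock (scan false 0 s))) := by
  have hlen : w.length = u.length + s.length + 1 := by simp [hw, add_assoc]
  have hcopy : ∀ t : Pass, t ≠ .whole → ∀ o, _ := fun t ht o =>
    run_copy_reset (w := w) (u := u ++ [Sym.box]) (s := s) (by simp [hw]) ht o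
  simp only [List.length_append, List.length_singleton] at hcopy
  have h := (hcopy .first (by simp) (o ++ [.conj, .know, .lparen, .neg, .lparen, .box])).trans <|
    (hcopy .second (by simp) _).trans <| (hcopy .third (by simp) _).trans <|
      hcopy .fourth (by simp) _
  have ho : o ++ [Sym.conj, .know, .lparen, .neg, .lparen, .box] ++ scan false 0 s ++
      Pass.first.next.1 ++ scan false 0 s ++ Pass.second.next.1 ++ scan false 0 s ++
      Pass.third.next.1 ++ scan false 0 s ++ Pass.fourth.next.1 =
      o ++ reflBlock (scan false 0 s) := by
    simp [reflBlock, Pass.next]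
  rw [ho] at h
  refine run_cons _ (Nat.zero_le _) (Nat.zero_le _)
    (by rw [hw, inCell_append_cons, translateProg]) ?_ h
  simp [execList, exec, Move.apply]
  omega

theorem run_loop {w u s : List Sym} (hw : w = u ++ s) (o : List Sym) :
    TRun w (conf .loop (u.length + 1) 0 0 o)
      (conf .loop (w.length + 1) 0 0 (o ++ reflBlocks s)) := by
  induction s generalizing u o with
  | nil =>
    rw [List.append_nil] at hw
    simpa [hw, reflBlocks] using LogSpace.Run.refl
  | cons c s ih =>
    have hlen : w.length = u.length + s.length + 1 := by simp [hw, add_assoc]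
    have ih := fun o => ih (u := u ++ [c]) (by simp [hw]) o
    simp only [List.length_append, List.length_singleton] at ih
    rw [reflBlocks]
    split_ifs with hc
    · subst hc
      rw [← List.append_assoc]
      exact (run_block hw o).trans (ih _)
    · refine run_cons [.move .right] (Nat.zero_le _) (Nat.zero_le _) ?_ ?_ (ih o)
      · rw [hw, inCell_append_cons]
        cases c <;> simp_all [translateProg]
      · simp [execList, exec, Move.apply]
        omega

theorem computable_translateString : Computable translateString := by
  refine translateMachine.computable fun w => ?_
  have hstart : TRun w translateMachine.init
      (conf (.copy .whole false) 1 0 0 (List.replicate (w.count .box) .lparen)) := by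
    have hinit : translateMachine.init = conf .count 0 0 0 [] := by
      have : (fun _ => 0 : Fin 2 → ℕ) = ![0, 0] := by ext i; fin_cases i <;> rfl
      exact congrArg (fun f => (TState.count, (⟨0, f, []⟩ : Data 2 Sym))) this
    rw [hinit]
    refine run_cons [.move .right] (Nat.zero_le _) (Nat.zero_le _) rfl ?_
      (run_count (u := []) rfl [])
    simp [execList, exec, Move.apply]
  by_cases hw : ScanOk w
  · refine ⟨_, hstart.trans ((run_copy_whole hw _).trans (run_loop (w := w) (u := []) rfl _)), ?_, ?_⟩
    · rw [step_conf, inCell_length]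
      rfl
    · simp [conf, translateString, hw, hw.1]
  · obtain ⟨p, d, e, h⟩ := run_copy_whole_of_not hw (List.replicate (w.count .box) .lparen)
    refine ⟨_, hstart.trans h, rfl, ?_⟩
    simp [conf, translateString, hw]

end BimodalLogic

theorem mainTheorem5 :
    (∃ f : List Sym → List Sym,
      LogSpace.IsReduction f
        (formulaLanguage (ProductSat .S4)) (formulaLanguage (ProductSat .K4)) ∧
      LogSpace.IsReduction f
        (formulaLanguage (CommutatorSat .S4)) (formulaLanguage (CommutatorSat .K4)) ∧
      ∀ φ : Formula, f φ.code = φ.translate.code) ∧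
    (∀ (φ : Formula) (l : List Formula), Formula.Enumerates l φ →
      (ProductSat .S4 φ ↔ ProductSat .K4 (φ.withReflAxioms l)) ∧
      (CommutatorSat .S4 φ ↔ CommutatorSat .K4 (φ.withReflAxioms l)) ∧
      ∀ (W : Type) (M : Model W) (w : W), M.IsCommutator .K4 → M.Holds w (φ.withReflAxioms l) →
        (M.reflReach w).IsCommutator .S4 ∧
        ∃ hw : w ∈ M.reachable w, (M.reflReach w).Holds ⟨w, hw⟩ φ) := by
  refine ⟨⟨translateString, ⟨computable_translateString, ?_⟩, ⟨computable_translateString, ?_⟩,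
    translateString_code⟩, fun φ l hl => ⟨productSat_iff hl, commutatorSat_iff hl,
      fun W M w hM h => ⟨Model.isCommutator_reflReach hM w, Model.mem_reachable_self hM w,
        Model.reflReach_holds hM w hl h⟩⟩⟩
  · exact mem_formulaLanguage_iff fun φ => productSat_iff (Formula.boxArgs_enumerates φ)
  · exact mem_formulaLanguage_iff fun φ => commutatorSat_iff (Formula.boxArgs_enumerates φ)
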